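/- Let $R$ be a discrete valuation ring with fraction field $K$ and residue field $k$, and let $\mathscr X \to \operatorname{Spec} R$ be a proper, regular, integral semistable curve (flat, with all geometric fibres reduced curves having at worst ordinary double points) whose generic fibre $X$ is a smooth geometrically integral curve over $K$. Let $\operatorname{Div}(X(K))$ be the group of divisors on $X$ supported on $K$-rational points. For $D \in \operatorname{Div}(X(K))$ let $\mathcal D$ be its closure in $\mathscr X$. Let $X_v$ ($v \in V$) be the irreducible components of the special fibre, and for a function $\varphi\colon V \to \mathbb Z$ (a twist) put $\mathcal O_{\mathscr X}(\mathcal D)(\varphi) = \mathcal O_{\mathscr X}\bigl(\mathcal D + \sum_v \varphi(v) X_v\bigr)$. Consider, for $D$ and one and the same twist $\varphi$, the conditions 1. $\mathcal O_{\mathscr X}(\mathcal D)(\varphi)$ has non-negative degree on every component $X_v$; 2. there are nonzero sections $s_v$ of $\mathcal O_{\mathscr X}(\mathcal D)(\varphi)|_{X_v}$ for all $v \in V$; 3. the sections $s_v$ agree at the common points of distinct components; 4. there is a global section of $\mathcal O_{\mathscr X}(\mathcal D)(\varphi)$ on $\mathscr X$ which restricts to $s_v$ on $X_v$ for every $v$.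 For $i = 1, 2, 3, 4$ say that $D$ satisfies steps $1$ to $i$ if there are a twist $\varphi$ and (for $i \ge 2$) sections $s_v$ for which the conditions $1, \dots, i$ hold. The rank $r_i(D)$ is $-1$ if $D$ does not satisfy steps $1$ to $i$; for $r \ge 0$, $r_i(D) = r$ if $D - E$ satisfies steps $1$ to $i$ for every effective $E \in \operatorname{Div}(X(K))$ of degree $r$, but not for some effective $E \in \operatorname{Div}(X(K))$ of degree $r + 1$. In other words, $r_i(D) + 1$ is the least degree of an effective $E \in \operatorname{Div}(X(K))$ such that $D - E$ does not satisfy steps $1$ to $i$ ($r_i(D)=\infty$ if there were no such $E$). Write $r_{\mathrm{num}}, r_{\mathrm{ab}}, r_{\mathrm{toric}}, r_X$ for $r_1, r_2, r_3, r_4$. Suppose that $X(K)$ is infinite. Then for every $D \in \operatorname{Div}(X(K))$ the space $H^0(X, \mathcal O_X(D))$ is finite-dimensional over $K$ and $$r_X(D) = \dim_K H^0(X, \mathcal O_X(D)) - 1 .$$ Consequently $$r_{\mathrm{num}}(D) \ \ge\ r_{\mathrm{ab}}(D) \ \ge\ r_{\mathrm{toric}}(D) \ \ge\ r_X(D) =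 \dim_K H^0(X, \mathcal O_X(D)) - 1 .$$ -/

import Mathlib

open CategoryTheory Limits AlgebraicGeometry

universe u

namespace GeomRank

noncomputable section

/-! ### Divisors and the sheaves `𝒪(A)` on a regular integral scheme -/

section Divisors

/-- A scheme all of whose local rings are regular. -/
class IsRegularScheme (Y : Scheme.{u}) : Prop where
  regular : ∀ y : Y, IsRegularLocalRing (Y.presheaf.stalk y)

variable {Y : Scheme.{u}} [IsIntegral Y] [IsLocallyNoetherian Y] [IsRegularScheme Y]

theorem isDiscreteValuationRing_stalk (z : Y) (hz : Order.coheight z = 1) :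
    IsDiscreteValuationRing (Y.presheaf.stalk z) := by
  have := IsRegularScheme.regular z
  have h1 := (IsRegularLocalRing.iff_finrank_cotangentSpace (Y.presheaf.stalk z)).mp this
  rw [ringKrullDim_stalk_eq_coheight, hz] at h1
  exact (IsLocalRing.finrank_CotangentSpace_eq_one_iff).mp (by exact_mod_cast h1)

/-- A Weil divisor on `Y` is written as a function `A : Y → ℤ` on points; only its values at points
of codimension one (the generic points of prime divisors) matter.  `stalkO A x` is the stalk at `x`
of `𝒪_Y(A)`, seen inside the function field: the rational functions `g` such that `div g + A` is
effective near `x`, that is, along all prime divisors through `x`. -/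
def stalkO (A : Y → ℤ) (x : Y) : Submodule (Y.presheaf.stalk x) Y.functionField where
  carrier := {g | g ≠ 0 → ∀ z : Y, z ⤳ x → Order.coheight z = 1 → 0 ≤ Scheme.ord g z + A z}
  zero_mem' := fun h => absurd rfl h
  add_mem' := by
    intro a b ha hb hab z hzx hz
    have := isDiscreteValuationRing_stalk z hz
    by_cases ha0 : a = 0
    · subst ha0; rw [zero_add] at hab ⊢; exact hb hab z hzx hz
    by_cases hb0 : b = 0
    · subst hb0; rw [add_zero] at hab ⊢; exact ha hab z hzx hz
    have h1 := ha ha0 z hzx hz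
    have h2 := hb hb0 z hzx hz
    have h3 := Scheme.ord_add (x := z) hab
    rcases min_le_iff.mp h3 with h | h <;> linarith
  smul_mem' := by
    intro c g hg hcg z hzx hz
    obtain ⟨U, hxU, a, rfl⟩ := Y.presheaf.exists_germ_eq c
    have hne : Nonempty U := ⟨⟨x, hxU⟩⟩
    have hzU : z ∈ U := hzx.mem_open U.isOpen hxU
    have hg0 : g ≠ 0 := by rintro rfl; simp at hcg
    have ha0 : a ≠ 0 := by rintro rfl; simp at hcg
    have key : (Y.presheaf.germ U x hxU a) • g = a • g := by
      rw [Algebra.smul_def, Algebra.smul_def, Scheme.algebraMap_germ_eq_germToFunctionField]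
      rfl
    have h1 := hg hg0 z hzx hz
    have h2 := Scheme.ord_le_smul hzU ha0 g
    rw [key]
    linarith

/-- For `v ⤳ x`: the prime ideal of `𝒪_{Y,x}` defining the reduced closed subscheme with
generic point `v`. -/
def primeAt {Y : Scheme.{u}} {v x : Y} (h : v ⤳ x) : Ideal (Y.presheaf.stalk x) :=
  (IsLocalRing.maximalIdeal (Y.presheaf.stalk v)).comap (Y.presheaf.stalkSpecializes h).hom

theorem primeAt_le {Y : Scheme.{u}} {v x : Y} (h : v ⤳ x) :
    primeAt h ≤ IsLocalRing.maximalIdeal (Y.presheaf.stalk x) :=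
  IsLocalRing.le_maximalIdeal (Ideal.comap_ne_top _ (Ideal.IsPrime.ne_top inferInstance))

/-- The stalk at `x` of the restriction of `𝒪_Y(A)` to the reduced closed subscheme `Z` with
generic point `v`, namely `𝒪_Y(A)_x / I_{Z,x} 𝒪_Y(A)_x`. -/
abbrev StalkRestrict (A : Y → ℤ) {v x : Y} (h : v ⤳ x) : Type u :=
  stalkO A x ⧸ (primeAt h • (⊤ : Submodule (Y.presheaf.stalk x) (stalkO A x)))

/-- The fibre `𝒪_Y(A) ⊗ κ(x)`. -/
abbrev Fibre (A : Y → ℤ) (x : Y) : Type u :=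
  stalkO A x ⧸ (IsLocalRing.maximalIdeal (Y.presheaf.stalk x) •
    (⊤ : Submodule (Y.presheaf.stalk x) (stalkO A x)))

/-- The value in the fibre at `x` of an element of the stalk of the restriction. -/
def toFibre (A : Y → ℤ) {v x : Y} (h : v ⤳ x) : StalkRestrict A h → Fibre A x :=
  Submodule.factor (Submodule.smul_mono_left (primeAt_le h))

/-- A global section of `𝒪_Y(A)|_Z`, where `Z` is the reduced closed subscheme with generic
point `v`: a family of elements of the stalks which is locally induced by sections of
`𝒪_Y(A)` over open subsets of `Y`. -/
structure RestrictedSection (A : Y → ℤ) (v : Y) where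
  val : ∀ (x : Y) (h : v ⤳ x), StalkRestrict A h
  isLocal : ∀ x : Y, v ⤳ x → ∃ U : Y.Opens, x ∈ U ∧ ∃ g : Y.functionField,
    ∀ y ∈ U, ∃ hg : g ∈ stalkO A y, ∀ h : v ⤳ y, val y h = Submodule.Quotient.mk ⟨g, hg⟩

/-- The rational function `g` induces a nonzero rational section of `𝒪_Y(A)|_Z`, whose order of
vanishing at `x ∈ Z` is `n`: if `e` generates `𝒪_Y(A)_x`, then `g = (a / b) e` for some
`a, b ∈ 𝒪_{Y,x}` not vanishing along `Z`, and `n` is the order of `a|_Z` minus that of `b|_Z`. -/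
def HasOrderAt (A : Y → ℤ) {v x : Y} (h : v ⤳ x) (g : Y.functionField) (n : ℤ) : Prop :=
  ∃ e : Y.functionField, stalkO A x = Submodule.span (Y.presheaf.stalk x) {e} ∧
    ∃ a b : Y.presheaf.stalk x, a ∉ primeAt h ∧ b ∉ primeAt h ∧ b • g = a • e ∧
      n = ((Ring.ord (Y.presheaf.stalk x ⧸ primeAt h) (Ideal.Quotient.mk _ a)).toNat : ℤ) -
        ((Ring.ord (Y.presheaf.stalk x ⧸ primeAt h) (Ideal.Quotient.mk _ b)).toNat : ℤ)

end Divisors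

/-! ### Semistable curves and regular semistable models -/

/-- The local ring of a curve over an algebraically closed field `k` is that of an ordinary double
point: its completion is isomorphic to `k[[x, y]] / (x y)`. -/
def IsOrdinaryDoublePoint (k : Type u) [Field k] (A : Type u) [CommRing A] [IsLocalRing A] : Prop :=
  Nonempty (AdicCompletion (IsLocalRing.maximalIdeal A) A ≃+*
    (MvPowerSeries (Fin 2) k ⧸
      Ideal.span {(MvPowerSeries.X 0 * MvPowerSeries.X 1 : MvPowerSeries (Fin 2) k)}))

/-- A semistable curve over `S`: flat, and every geometric fibre is a reduced curve (of dimension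
one at each closed point) whose closed points are regular points or ordinary double points. -/
structure IsSemistable {X S : Scheme.{u}} (f : X ⟶ S) : Prop where
  flat : Flat f
  reduced : ∀ (k : Type u) [Field k] [IsAlgClosed k] (s : Spec (.of k) ⟶ S),
    IsReduced (pullback f s)
  nodal : ∀ (k : Type u) [Field k] [IsAlgClosed k] (s : Spec (.of k) ⟶ S)
    (x : (pullback f s : Scheme.{u})), IsClosed ({x} : Set (pullback f s : Scheme.{u})) →
      ringKrullDim ((pullback f s).presheaf.stalk x) = 1 ∧
      (IsRegularLocalRing ((pullback f s).presheaf.stalk x) ∨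
        IsOrdinaryDoublePoint k ((pullback f s).presheaf.stalk x))

/-- A proper regular semistable model, over a discrete valuation ring `R` with fraction field `K`,
of a smooth geometrically integral curve over `K`. -/
structure RegularSemistableModel (R K : Type u) [CommRing R] [IsDomain R]
    [IsDiscreteValuationRing R] [Field K] [Algebra R K] [IsFractionRing R K] where
  /-- the total space -/
  X : Scheme.{u}
  /-- the structure morphism -/
  f : X ⟶ Spec (.of R)
  isIntegral : IsIntegral X
  isProper : IsProper f
  isRegular : IsRegularScheme X
  isSemistable : IsSemistable f
  smooth_generic :
    SmoothOfRelativeDimension 1 (pullback.snd f (Spec.map (CommRingCat.ofHom (algebraMap R K))))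
  geometricallyIntegral_generic :
    GeometricallyIntegral (pullback.snd f (Spec.map (CommRingCat.ofHom (algebraMap R K))))

namespace RegularSemistableModel

variable {R K : Type u} [CommRing R] [IsDomain R] [IsDiscreteValuationRing R] [Field K]
  [Algebra R K] [IsFractionRing R K] (M : RegularSemistableModel R K)

instance : IsIntegral M.X := M.isIntegral
instance : IsRegularScheme M.X := M.isRegular
instance : IsLocallyNoetherian M.X :=
  haveI := M.isProper
  LocallyOfFiniteType.isLocallyNoetherian M.f

/-- The generic fibre. -/
def genericFibre : Scheme.{u} :=
  pullback M.f (Spec.map (CommRingCat.ofHom (algebraMap R K)))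

/-- The inclusion of the generic fibre into the model. -/
def ι : M.genericFibre ⟶ M.X := pullback.fst _ _

/-- The structure morphism of the generic fibre. -/
def toSpecK : M.genericFibre ⟶ Spec (.of K) := pullback.snd _ _

instance : IsIntegral M.genericFibre :=
  haveI : GeometricallyIntegral M.toSpecK := M.geometricallyIntegral_generic
  GeometricallyIntegral.isIntegral_of_subsingleton M.toSpecK

instance : IsLocallyNoetherian M.genericFibre :=
  haveI := M.isProper
  haveI : LocallyOfFiniteType M.toSpecK :=
    inferInstanceAs (LocallyOfFiniteType
      (pullback.snd M.f (Spec.map (CommRingCat.ofHom (algebraMap R K)))))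
  LocallyOfFiniteType.isLocallyNoetherian M.toSpecK

theorem isLocalization_away_of_irreducible (R K : Type u) [CommRing R] [IsDomain R]
    [IsDiscreteValuationRing R] [Field K] [Algebra R K] [IsFractionRing R K] (ϖ : R)
    (hϖ : Irreducible ϖ) : IsLocalization.Away ϖ K := by
  refine (IsLocalization.iff_of_le_of_exists_dvd (S := K) (Submonoid.powers ϖ) (nonZeroDivisors R)
    (powers_le_nonZeroDivisors_of_noZeroDivisors hϖ.ne_zero) fun n hn => ?_).mpr inferInstance
  obtain ⟨k, hk⟩ := IsDiscreteValuationRing.associated_pow_irreducible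
    (nonZeroDivisors.ne_zero hn) hϖ
  exact ⟨ϖ ^ k, ⟨k, rfl⟩, hk.dvd⟩

instance : IsOpenImmersion M.ι := by
  obtain ⟨ϖ, hϖ⟩ := IsDiscreteValuationRing.exists_irreducible R
  have := isLocalization_away_of_irreducible R K ϖ hϖ
  have : IsOpenImmersion (Spec.map (CommRingCat.ofHom (algebraMap R K))) :=
    IsOpenImmersion.of_isLocalization ϖ
  exact MorphismProperty.pullback_fst _ _ this

instance : IsRegularScheme M.genericFibre where
  regular y :=
    haveI := M.isRegular.regular (M.ι y)
    IsRegularLocalRing.of_ringEquiv (asIso (M.ι.stalkMap y)).commRingCatIsoToRingEquiv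

/-- The function field of the generic fibre is an extension of `K`. -/
instance : Algebra K M.genericFibre.functionField :=
  ((Scheme.ΓSpecIso (.of K)).inv ≫ M.toSpecK.appTop ≫
    M.genericFibre.presheaf.germ ⊤ (genericPoint M.genericFibre) (Set.mem_univ _)).hom.toAlgebra

/-- The set of `K`-points of the generic fibre. -/
def Points : Type u := {P : Spec (.of K) ⟶ M.genericFibre // P ≫ M.toSpecK = 𝟙 _}

/-- The group of divisors on the generic fibre supported on `K`-points. -/
abbrev Div : Type u := M.Points →₀ ℤ

variable {M}

/-- The point of the generic fibre underlying a `K`-point. -/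
def Points.pt (P : M.Points) : M.genericFibre := P.1 (IsLocalRing.closedPoint K)

open Classical in
/-- A divisor supported on `K`-points as a Weil divisor on the generic fibre. -/
def genericDivisor (D : M.Div) : M.genericFibre → ℤ :=
  fun z => D.sum fun P n => if P.pt = z then n else 0

open Classical in
/-- The closure on the model of a divisor supported on `K`-points: the point `P` of the generic
fibre becomes the prime divisor of the model with generic point `P`. -/
def closure (D : M.Div) : M.X → ℤ :=
  fun z => D.sum fun P n => if M.ι P.pt = z then n else 0

/-- `H⁰` of the generic fibre with values in `𝒪(D)`, as a `K`-vector space of rational functions. -/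
def H0 (D : M.Div) : Submodule K M.genericFibre.functionField where
  carrier := {g | ∀ x, g ∈ stalkO (genericDivisor D) x}
  zero_mem' := fun x => zero_mem _
  add_mem' := fun ha hb x => add_mem (ha x) (hb x)
  smul_mem' := by
    intro c g hg x
    have hx : x ∈ (⊤ : M.genericFibre.Opens) := Set.mem_univ _
    have hne : Nonempty (⊤ : M.genericFibre.Opens) := ⟨⟨x, hx⟩⟩
    have h : c • g = (M.genericFibre.presheaf.germ ⊤ x hx
        (((Scheme.ΓSpecIso (.of K)).inv ≫ M.toSpecK.appTop) c)) • g := by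
      rw [Algebra.smul_def, Algebra.smul_def, Scheme.algebraMap_germ_eq_germToFunctionField]
      rfl
    rw [h]
    exact Submodule.smul_mem _ _ (hg x)

variable (M)

/-- `v` is the generic point of an irreducible component of the special fibre. -/
def IsComponent (v : M.X) : Prop :=
  M.f v = IsLocalRing.closedPoint R ∧
    ∀ w : M.X, M.f w = IsLocalRing.closedPoint R → w ⤳ v → w = v

/-- The irreducible components of the special fibre (the vertices of the dual graph), given by
their generic points. -/
def Component : Type u := {v : M.X // M.IsComponent v}

variable {M}

open Classical in
/-- The twist `V_φ = ∑ φ(v) X_v`. -/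
def twist (φ : M.Component → ℤ) : M.X → ℤ :=
  fun z => if h : M.IsComponent z then φ ⟨z, h⟩ else 0

/-- The degree of `𝒪(A)` on the component `X_v` is `d`: some nonzero rational section of
`𝒪(A)|_{X_v}` has a divisor `∑ n_x x` of degree `d = ∑ n_x [κ(x) : k]`, where `k` is the residue
field of `R`.  (The degree does not depend on the rational section, as `X_v` is proper.) -/
def HasDegree (A : M.X → ℤ) (v : M.Component) (d : ℤ) : Prop :=
  ∃ (g : M.X.functionField) (n : {x : M.X // v.1 ⤳ x ∧ IsClosed ({x} : Set M.X)} →₀ ℤ),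
    (∀ x, HasOrderAt A x.2.1 g (n x)) ∧
    d = n.sum fun x m => m * (M.f.residueDegree x.1 : ℤ)

/-- A family of sections of `𝒪(A)|_{X_v}`, one for each component `X_v`. -/
abbrev SectionFamily (A : M.X → ℤ) : Type u :=
  ∀ v : M.Component, RestrictedSection A v.1

/-- (1) `𝒪(A)` has nonnegative degree on every component of the special fibre. -/
def NonnegDegrees (A : M.X → ℤ) : Prop :=
  ∀ v : M.Component, ∃ d : ℤ, 0 ≤ d ∧ HasDegree A v d

/-- (2) None of the sections `s_v` of `𝒪(A)|_{X_v}` is the zero section. -/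
def SectionFamily.Nonzero {A : M.X → ℤ} (s : SectionFamily A) : Prop :=
  ∀ v : M.Component, ∃ (x : M.X) (h : v.1 ⤳ x), (s v).val x h ≠ 0

/-- (3) The sections `s_v` agree across nodes: at any common point of two components,
they take the same value. -/
def SectionFamily.AgreeAtNodes {A : M.X → ℤ} (s : SectionFamily A) : Prop :=
  ∀ (v w : M.Component) (x : M.X) (hv : v.1 ⤳ x) (hw : w.1 ⤳ x),
    toFibre A hv ((s v).val x hv) = toFibre A hw ((s w).val x hw)

/-- (4) The section formed from the `s_v` extends to a global section of `𝒪(A)` on the model. -/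
def SectionFamily.Extends {A : M.X → ℤ} (s : SectionFamily A) : Prop :=
  ∃ (g : M.X.functionField) (hg : ∀ x : M.X, g ∈ stalkO A x),
    ∀ (v : M.Component) (x : M.X) (h : v.1 ⤳ x),
      (s v).val x h = Submodule.Quotient.mk ⟨g, hg x⟩

/-- `D` satisfies step (1). -/
def SatisfiesNum (D : M.Div) : Prop :=
  ∃ φ : M.Component → ℤ, NonnegDegrees (closure D + twist φ)

/-- `D` satisfies steps (1) and (2). -/
def SatisfiesAb (D : M.Div) : Prop :=
  ∃ φ : M.Component → ℤ, NonnegDegrees (closure D + twist φ) ∧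
    ∃ s : SectionFamily (closure D + twist φ), s.Nonzero

/-- `D` satisfies steps (1) to (3). -/
def SatisfiesToric (D : M.Div) : Prop :=
  ∃ φ : M.Component → ℤ, NonnegDegrees (closure D + twist φ) ∧
    ∃ s : SectionFamily (closure D + twist φ), s.Nonzero ∧ s.AgreeAtNodes

/-- `D` satisfies steps (1) to (4). -/
def SatisfiesX (D : M.Div) : Prop :=
  ∃ φ : M.Component → ℤ, NonnegDegrees (closure D + twist φ) ∧
    ∃ s : SectionFamily (closure D + twist φ), s.Nonzero ∧ s.AgreeAtNodes ∧ s.Extends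

/-- The degree of a divisor supported on `K`-points. -/
def deg (D : M.Div) : ℤ := D.sum fun _ n => n

/-- "The rank of `D` with respect to the condition `S` is `r`": `r = -1` and `D` fails `S`; or
`r ≥ 0`, `D - E` satisfies `S` for every effective `E` of degree `r`, and `D - E` fails `S` for
some effective `E` of degree `r + 1`. -/
def HasRank (S : M.Div → Prop) (D : M.Div) (r : ℤ) : Prop :=
  (r = -1 ∧ ¬ S D) ∨
    (0 ≤ r ∧ (∀ E : M.Div, 0 ≤ E → deg E = r → S (D - E)) ∧
      ∃ E : M.Div, 0 ≤ E ∧ deg E = r + 1 ∧ ¬ S (D - E))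

/-- The rank of `D` with respect to the condition `S`, as an extended number: one less than the
least degree of an effective `E` such that `D - E` fails `S`. -/
def rank (S : M.Div → Prop) (D : M.Div) : EReal :=
  ⨅ E : {E : M.Div // 0 ≤ E ∧ ¬ S (D - E)}, (((deg E.1 - 1 : ℤ) : ℝ) : EReal)

/-- The numerical rank. -/
def rNum (D : M.Div) : EReal := rank SatisfiesNum D

/-- The abelian rank. -/
def rAb (D : M.Div) : EReal := rank SatisfiesAb D

/-- The toric rank. -/
def rToric (D : M.Div) : EReal := rank SatisfiesToric D

/-- The finest geometric rank `r_X`. -/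
def rX (D : M.Div) : EReal := rank SatisfiesX D

end RegularSemistableModel

end

end GeomRank

/-! Everything rests on the equivalence `satisfiesX_iff`: steps (1) to (4) hold for D exactly when
𝒪(D) has a nonzero section on the generic fibre. A global section on the model is a rational
function g, and restricting it to the generic fibre forgets the twist. Conversely, a nonzero g in
H⁰(X, 𝒪(D)) is given the twist φ(v) = -ord_v g. It then has no pole and does not vanish along any
component, so its restrictions are the required s_v. They agree at nodes because they come from one
function, and the degrees are nonnegative because g itself restricts to a section with an effective
divisor. This last point needs 𝒪(A) to be locally free of rank one, that is, factoriality of regular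
local rings of dimension at most two. Semistability enters through the dimension of the fibres.

The rest is linear algebra in h⁰. Subtracting a rational point lowers h⁰ by at most one, as sections
are compared by their value in K (`exists_sub_smul_mem`). If h⁰(D) > 0, it drops by exactly one at a
rational point outside the support of D and away from the zeros and poles of a chosen nonzero
section. Infinitely many K-points guarantee that such a point exists. So h⁰(D) is the least degree
of an effective E with h⁰(D - E) = 0 (`h0_le_h0_sub_add`, `exists_h0_sub_add_eq`).
Finite-dimensionality follows from the case D = 0, where properness gives it, by moving one point at
a time. The remaining inequalities are formal: a weaker condition has a larger rank. -/

namespace GeomRank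

/-! ### Commutative algebra: factoriality of regular local rings of dimension at most two. -/

section Algebra

open IsLocalRing

/-- A Noetherian local ring with principal maximal ideal is a principal ideal ring. -/
theorem isPrincipalIdealRing_of_maximalIdeal_isPrincipal (A : Type*) [CommRing A] [IsLocalRing A]
    [IsNoetherianRing A] (h : (maximalIdeal A).IsPrincipal) : IsPrincipalIdealRing A := by
  refine IsPrincipalIdealRing.of_prime fun q hq => ?_
  obtain ⟨y, hy⟩ := h
  by_cases hyq : y ∈ q
  · have : q = maximalIdeal A :=
      le_antisymm (le_maximalIdeal hq.ne_top) (by rw [hy]; simpa [Ideal.span_le] using hyq)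
    exact ⟨y, this ▸ hy⟩
  · suffices q ≤ ⊥ by rw [le_bot_iff.mp this]; exact bot_isPrincipal
    -- Nakayama: an element of q is b y, and y ∉ q forces b ∈ q, so q = 𝔪 q.
    refine Submodule.le_of_le_smul_of_le_jacobson_bot (I := maximalIdeal A) (IsNoetherian.noetherian q)
      (maximalIdeal_le_jacobson _) fun a ha => ?_
    have ham : a ∈ maximalIdeal A := le_maximalIdeal hq.ne_top ha
    rw [hy] at ham
    obtain ⟨b, rfl⟩ := Submodule.mem_span_singleton.mp ham
    have hb : b ∈ q := (hq.mem_or_mem ha).resolve_right hyq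
    rw [bot_sup_eq, smul_eq_mul b, mul_comm b]
    exact Submodule.smul_mem_smul (by rw [hy]; exact Submodule.mem_span_singleton_self y) hb

/-- If the maximal ideal of a Noetherian local ring is generated by `x` and `y`, then every prime
ideal not containing `x` is principal. -/
theorem isPrincipal_of_notMem_of_maximalIdeal_eq {A : Type*} [CommRing A] [IsLocalRing A]
    [IsNoetherianRing A] {x y : A} (h : maximalIdeal A = Ideal.span {x, y}) (p : Ideal A)
    [hp : p.IsPrime] (hx : x ∉ p) : p.IsPrincipal := by
  have hxm : x ∈ maximalIdeal A := by rw [h]; exact Ideal.subset_span (by simp)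
  have hne : Ideal.span {x} ≠ ⊤ := fun e =>
    (maximalIdeal.isMaximal A).ne_top (top_le_iff.mp (e ▸ by simpa [Ideal.span_le] using hxm))
  have : Nontrivial (A ⧸ Ideal.span {x}) := Ideal.Quotient.nontrivial_iff.mpr hne
  have : IsLocalRing (A ⧸ Ideal.span {x}) :=
    .of_surjective' (Ideal.Quotient.mk _) Ideal.Quotient.mk_surjective
  have hmax : maximalIdeal (A ⧸ Ideal.span {x}) = (maximalIdeal A).map (Ideal.Quotient.mk _) := by
    refine ((Ideal.map_eq_top_or_isMaximal_of_surjective _ Ideal.Quotient.mk_surjective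
      (maximalIdeal.isMaximal A)).resolve_left ?_ |> eq_maximalIdeal).symm
    intro ht
    have := congrArg (Ideal.comap (Ideal.Quotient.mk (Ideal.span {x}))) ht
    rw [Ideal.comap_map_of_surjective _ Ideal.Quotient.mk_surjective, Ideal.comap_top,
      ← RingHom.ker_eq_comap_bot, Ideal.mk_ker, sup_eq_left.mpr] at this
    · exact (maximalIdeal.isMaximal A).ne_top this
    · simpa [Ideal.span_le] using hxm
  have hprin : (maximalIdeal (A ⧸ Ideal.span {x})).IsPrincipal := by
    refine ⟨Ideal.Quotient.mk _ y, ?_⟩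
    rw [hmax, h, Ideal.map_span, Set.image_pair, (Ideal.Quotient.eq_zero_iff_mem).mpr
      (Ideal.mem_span_singleton_self x), Ideal.span_insert_zero]
  have := isPrincipalIdealRing_of_maximalIdeal_isPrincipal _ hprin
  obtain ⟨fbar, hf⟩ := IsPrincipalIdealRing.principal (p.map (Ideal.Quotient.mk (Ideal.span {x})))
  obtain ⟨f, hfp, rfl⟩ : ∃ f ∈ p, Ideal.Quotient.mk (Ideal.span {x}) f = fbar :=
    (Ideal.mem_map_iff_of_surjective _ Ideal.Quotient.mk_surjective).mp
      (hf ▸ Submodule.mem_span_singleton_self fbar)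
  refine ⟨f, le_antisymm ?_ (by simpa [Ideal.span_le] using hfp)⟩
  -- Modulo x the ideal p is generated by the class of f. So a ∈ p is r f + b x, and x ∉ p gives b ∈
  -- p; hence p = (f) + 𝔪 p and Nakayama applies.
  refine Submodule.le_of_le_smul_of_le_jacobson_bot (I := maximalIdeal A) (IsNoetherian.noetherian p)
    (maximalIdeal_le_jacobson _) fun a ha => ?_
  have h1 := Ideal.mem_map_of_mem (Ideal.Quotient.mk (Ideal.span {x})) ha
  rw [hf] at h1
  obtain ⟨rbar, hr⟩ := Submodule.mem_span_singleton.mp h1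
  obtain ⟨r, rfl⟩ := Ideal.Quotient.mk_surjective rbar
  rw [smul_eq_mul, ← map_mul, eq_comm, Ideal.Quotient.eq, Ideal.mem_span_singleton'] at hr
  obtain ⟨b, hb⟩ := hr
  have hbp : b ∈ p := by
    refine (hp.mem_or_mem ?_).resolve_right hx
    rw [hb]
    exact p.sub_mem ha (p.mul_mem_left r hfp)
  rw [← sub_add_cancel a (r * f), ← hb, add_comm]
  refine Submodule.add_mem_sup (Submodule.mem_span_singleton.mpr ⟨r, rfl⟩) ?_
  rw [mul_comm]
  exact Submodule.smul_mem_smul hxm hbp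

/-- A regular local domain of dimension at most two is factorial. -/
theorem uniqueFactorizationMonoid_of_ringKrullDim_le_two (A : Type*) [CommRing A] [IsDomain A]
    [IsRegularLocalRing A] (h : ringKrullDim A ≤ 2) : UniqueFactorizationMonoid A := by
  have hs : ((maximalIdeal A).spanFinrank : WithBot ℕ∞) = ringKrullDim A :=
    IsRegularLocalRing.spanFinrank_maximalIdeal
  have hfg : (maximalIdeal A).FG := IsNoetherian.noetherian _
  have hle : (maximalIdeal A).spanFinrank ≤ 2 := by rw [← hs] at h; exact_mod_cast h
  have hspan := Submodule.span_generators (maximalIdeal A)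
  have hcard := Submodule.FG.generators_ncard hfg
  have hfin := Submodule.FG.finite_generators hfg
  by_cases h2 : (maximalIdeal A).spanFinrank = 2
  · rw [h2, Set.ncard_eq_two] at hcard
    obtain ⟨x, y, -, hxy⟩ := hcard
    rw [hxy] at hspan
    refine .of_forall_isPrincipal_of_height_eq_one fun p hp hph => ?_
    -- A prime of height one misses one of the two generators, since otherwise it would be the
    -- maximal ideal, of height two.
    by_cases hx : x ∈ p
    · by_cases hy : y ∈ p
      · have : p = maximalIdeal A := by
          refine le_antisymm (le_maximalIdeal hp.ne_top) ?_
          rw [← hspan, Submodule.span_le, Set.pair_subset_iff]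
          exact ⟨hx, hy⟩
        have h3 := IsLocalRing.maximalIdeal_height_eq_ringKrullDim (R := A)
        rw [← this, hph, ← hs, h2] at h3
        exact absurd h3 (by decide)
      · exact isPrincipal_of_notMem_of_maximalIdeal_eq (x := y) (y := x)
          (by rw [Set.pair_comm]; exact hspan.symm) p hy
    · exact isPrincipal_of_notMem_of_maximalIdeal_eq hspan.symm p hx
  · have : (maximalIdeal A).IsPrincipal := by
      rw [← hspan]
      obtain h0 | ⟨x, hx⟩ := (Set.ncard_le_one_iff_eq hfin).mp (by rw [hcard]; omega)
      · rw [h0, Submodule.span_empty]; exact bot_isPrincipal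
      · rw [hx]; exact ⟨x, rfl⟩
    have := isPrincipalIdealRing_of_maximalIdeal_isPrincipal A this
    infer_instance

/-- The order of vanishing is invariant under isomorphisms of discrete valuation rings. -/
theorem ordFrac_ringEquiv {A B K L : Type*} [CommRing A] [IsDomain A] [IsDiscreteValuationRing A]
    [CommRing B] [IsDomain B] [IsDiscreteValuationRing B] [Field K] [Field L] [Algebra A K]
    [IsFractionRing A K] [Algebra B L] [IsFractionRing B L] (e : A ≃+* B) (F : K →+* L)
    (hF : ∀ a, F (algebraMap A K a) = algebraMap B L (e a)) (g : K) :
    Ring.ordFrac B (F g) = Ring.ordFrac A g := by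
  have key : ∀ a : A, Ring.ordFrac B (F (algebraMap A K a)) = Ring.ordFrac A (algebraMap A K a) := by
    intro a
    by_cases ha : a = 0
    · simp [ha]
    obtain ⟨ϖ, hϖ⟩ := IsDiscreteValuationRing.exists_irreducible A
    obtain ⟨n, u, rfl⟩ := IsDiscreteValuationRing.eq_unit_mul_pow_irreducible ha hϖ
    have h1 : Irreducible (e ϖ) := (MulEquiv.irreducible_iff e).mpr hϖ
    have h2 : IsUnit (e u) := u.isUnit.map e
    simp only [hF, map_mul, map_pow, Ring.ordFrac_irreducible hϖ, Ring.ordFrac_irreducible h1,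
      Ring.ordFrac_of_isUnit h2, Ring.ordFrac_of_isUnit u.isUnit]
  obtain ⟨a, b, hb, rfl⟩ := IsFractionRing.div_surjective (A := A) g
  simp only [map_div₀, key]

end Algebra

/-! ### Generizations of a point and primes of its local ring. -/

section Generizations

variable {Y : Scheme.{u}}

instance primeAt_isPrime {v x : Y} (h : v ⤳ x) : (primeAt h).IsPrime :=
  Ideal.IsPrime.comap _

theorem mem_primeAt_iff {v x : Y} (h : v ⤳ x) (a : Y.presheaf.stalk x) :
    a ∈ primeAt h ↔ ¬ IsUnit ((Y.presheaf.stalkSpecializes h).hom a) :=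
  IsLocalRing.mem_maximalIdeal _

theorem stalkSpecializes_trans_apply {w z x : Y} (h : w ⤳ z) (h' : z ⤳ x)
    (a : Y.presheaf.stalk x) :
    (Y.presheaf.stalkSpecializes h).hom ((Y.presheaf.stalkSpecializes h').hom a) =
      (Y.presheaf.stalkSpecializes (h.trans h')).hom a := by
  rw [← Y.presheaf.stalkSpecializes_comp h h']
  rfl

theorem lt_of_specializes_of_ne {w z : Y} (h : w ⤳ z) (hne : w ≠ z) : z < w :=
  lt_of_le_not_ge h fun h' => hne (h.antisymm h').eq

theorem primeAt_refl (x : Y) :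
    primeAt (specializes_rfl : x ⤳ x) = IsLocalRing.maximalIdeal (Y.presheaf.stalk x) := by
  ext a
  rw [primeAt, Y.presheaf.stalkSpecializes_refl]
  rfl

theorem primeAt_le_primeAt {w z x : Y} (h : w ⤳ z) (h' : z ⤳ x) :
    primeAt (h.trans h') ≤ primeAt h' := by
  intro a ha
  rw [mem_primeAt_iff] at ha ⊢
  exact fun hu => ha (by
    rw [← stalkSpecializes_trans_apply h h']
    exact hu.map (Y.presheaf.stalkSpecializes h).hom)

/-- The map from Spec 𝒪_z factors through Spec 𝒪_x, and its closed point lies over z. -/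
theorem fromSpecStalk_primeAt {z x : Y} (h : z ⤳ x) :
    Y.fromSpecStalk x ⟨primeAt h, inferInstance⟩ = z := by
  have h1 := Scheme.fromSpecStalk_closedPoint (x := z)
  rw [← Scheme.SpecMap_stalkSpecializes_fromSpecStalk h] at h1
  exact h1

theorem specializes_of_primeAt_le {w z x : Y} (hw : w ⤳ x) (hz : z ⤳ x)
    (h : primeAt hw ≤ primeAt hz) : w ⤳ z := by
  have h1 : (⟨primeAt hw, inferInstance⟩ : PrimeSpectrum (Y.presheaf.stalk x)) ⤳
      ⟨primeAt hz, inferInstance⟩ := (PrimeSpectrum.le_iff_specializes _ _).mp h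
  have h2 := h1.map (Y.fromSpecStalk x).continuous
  erw [fromSpecStalk_primeAt, fromSpecStalk_primeAt] at h2
  exact h2

theorem eq_of_primeAt_eq {w z x : Y} (hw : w ⤳ x) (hz : z ⤳ x)
    (h : primeAt hw = primeAt hz) : w = z :=
  (specializes_of_primeAt_le hw hz h.le).antisymm (specializes_of_primeAt_le hz hw h.ge) |>.eq

/-- Every prime ideal of the local ring at `x` comes from a generization of `x`. -/
theorem exists_primeAt_eq {x : Y} (q : Ideal (Y.presheaf.stalk x)) [hq : q.IsPrime] :
    ∃ (z : Y) (h : z ⤳ x), primeAt h = q := by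
  have hz : Y.fromSpecStalk x ⟨q, hq⟩ ⤳ x := by
    have : Y.fromSpecStalk x ⟨q, hq⟩ ∈ Set.range (Y.fromSpecStalk x) := ⟨_, rfl⟩
    rwa [Scheme.range_fromSpecStalk] at this
  refine ⟨_, hz, ?_⟩
  have h1 := (Y.fromSpecStalk x).isEmbedding.injective (fromSpecStalk_primeAt hz)
  exact congrArg PrimeSpectrum.asIdeal h1

/-- The local ring at a generization `z` of `x` is a localization of the local ring at `x`. -/
theorem exists_stalkSpecializes_mul_eq {z x : Y} (h : z ⤳ x) (t : Y.presheaf.stalk z) :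
    ∃ a s : Y.presheaf.stalk x, s ∉ primeAt h ∧
      (Y.presheaf.stalkSpecializes h).hom s * t = (Y.presheaf.stalkSpecializes h).hom a := by
  obtain ⟨_, ⟨U, hU, rfl⟩, hxU, -⟩ :=
    Y.isBasis_affineOpens.exists_subset_of_mem_open (Set.mem_univ x) isOpen_univ
  have hzU : z ∈ U := h.mem_open U.2 hxU
  let := TopCat.Presheaf.algebra_section_stalk Y.presheaf (⟨z, hzU⟩ : U)
  have := hU.isLocalization_stalk ⟨z, hzU⟩
  obtain ⟨⟨a, s⟩, e⟩ := IsLocalization.surj (hU.primeIdealOf ⟨z, hzU⟩).asIdeal.primeCompl t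
  have hg : ∀ b : Γ(Y, U), (Y.presheaf.stalkSpecializes h).hom (Y.presheaf.germ U x hxU b) =
      Y.presheaf.germ U z hzU b := fun b => by
    rw [← Y.presheaf.germ_stalkSpecializes hxU h]
    rfl
  refine ⟨Y.presheaf.germ U x hxU a, Y.presheaf.germ U x hxU s.1, ?_, ?_⟩
  · rw [mem_primeAt_iff, not_not, hg]
    exact IsLocalization.map_units (Y.presheaf.stalk z) s
  · rw [hg, hg, mul_comm]
    exact e

end Generizations

/-! ### Points of codimension one and prime elements. -/

section CodimensionOne

variable {Y : Scheme.{u}} [IsIntegral Y]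

theorem coheight_genericPoint : Order.coheight (genericPoint Y) = 0 :=
  Order.coheight_eq_zero.mpr isMax_top

theorem eq_genericPoint_of_coheight_eq_zero {z : Y} (h : Order.coheight z = 0) :
    z = genericPoint Y := by
  have h1 : IsMax z := Order.coheight_eq_zero.mp h
  exact ((genericPoint_specializes z).antisymm (h1 (genericPoint_specializes z))).eq.symm

theorem coheight_eq_one_iff {z : Y} : Order.coheight z = 1 ↔
    z ≠ genericPoint Y ∧ ∀ w, w ⤳ z → w = z ∨ w = genericPoint Y := by
  constructor
  · intro h
    refine ⟨fun e => by rw [e, coheight_genericPoint] at h; simp at h, fun w hw => ?_⟩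
    by_contra! hc
    have h1 := Order.coheight_add_one_le (lt_of_specializes_of_ne hw hc.1)
    rw [h] at h1
    refine hc.2 (eq_genericPoint_of_coheight_eq_zero ?_)
    have h2 : Order.coheight w + 1 ≤ 0 + 1 := by simpa using h1
    simpa using (ENat.add_le_add_iff_right ENat.one_ne_top).mp h2
  · rintro ⟨h1, h2⟩
    refine le_antisymm ?_ ?_
    · refine (Order.coheight_le_coe_iff (n := 1)).mpr fun w hw => ?_
      have hw' : w ⤳ z := hw.le
      rcases h2 w hw' with rfl | rfl
      · exact absurd hw (lt_irrefl _)
      · rw [coheight_genericPoint]; simp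
    · rw [Order.one_le_iff_ne_zero]
      exact fun h => h1 (eq_genericPoint_of_coheight_eq_zero h)

theorem algebraMap_stalkSpecializes {z x : Y} (h : z ⤳ x) (a : Y.presheaf.stalk x) :
    algebraMap (Y.presheaf.stalk z) Y.functionField ((Y.presheaf.stalkSpecializes h).hom a) =
      algebraMap (Y.presheaf.stalk x) Y.functionField a :=
  stalkSpecializes_trans_apply _ h a

theorem algebraMap_ne_zero {x : Y} {a : Y.presheaf.stalk x} (ha : a ≠ 0) :
    algebraMap (Y.presheaf.stalk x) Y.functionField a ≠ 0 := fun h =>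
  ha (IsFractionRing.injective (Y.presheaf.stalk x) Y.functionField (by rw [h, map_zero]))

theorem stalkSpecializes_injective {z x : Y} (h : z ⤳ x) :
    Function.Injective (Y.presheaf.stalkSpecializes h).hom := fun a b hab =>
  IsFractionRing.injective (Y.presheaf.stalk x) Y.functionField (by
    rw [← algebraMap_stalkSpecializes h, hab, algebraMap_stalkSpecializes])

theorem primeAt_eq_bot_iff {z x : Y} (h : z ⤳ x) : primeAt h = ⊥ ↔ z = genericPoint Y := by
  have key : primeAt (genericPoint_specializes x) = ⊥ := by
    refine (Submodule.eq_bot_iff _).mpr fun a ha => ?_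
    by_contra h0
    rw [mem_primeAt_iff] at ha
    exact ha (isUnit_iff_ne_zero.mpr fun h1 =>
      h0 (stalkSpecializes_injective (genericPoint_specializes x) (by rw [h1, map_zero])))
  constructor
  · exact fun h1 => eq_of_primeAt_eq h (genericPoint_specializes x) (h1.trans key.symm)
  · rintro rfl
    exact key

section Factorial

variable {x : Y} [UniqueFactorizationMonoid (Y.presheaf.stalk x)]

/-- A nonzero prime inside (π) contains a prime element, which is divisible by π and hence
associated to it; so nothing lies strictly between (π) and the zero ideal. -/
theorem exists_coheight_eq_one_of_prime {π : Y.presheaf.stalk x} (hπ : Prime π) :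
    ∃ (z : Y) (h : z ⤳ x), Order.coheight z = 1 ∧ primeAt h = Ideal.span {π} := by
  have := (Ideal.span_singleton_prime hπ.ne_zero).mpr hπ
  obtain ⟨z, h, hz⟩ := exists_primeAt_eq (Ideal.span {π})
  refine ⟨z, h, coheight_eq_one_iff.mpr ⟨fun e => ?_, fun w hw => or_iff_not_imp_right.mpr
    fun hne => ?_⟩, hz⟩
  · rw [(primeAt_eq_bot_iff h).mpr e, eq_comm, Ideal.span_singleton_eq_bot] at hz
    exact hπ.ne_zero hz
  · obtain ⟨ρ, hρw, hρ⟩ := Ideal.IsPrime.exists_mem_prime_of_ne_bot (primeAt_isPrime (hw.trans h))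
      (fun e => hne ((primeAt_eq_bot_iff _).mp e))
    have h1 : ρ ∈ Ideal.span {π} := hz ▸ primeAt_le_primeAt hw h hρw
    have h2 : Associated π ρ := hπ.associated_of_dvd hρ (Ideal.mem_span_singleton.mp h1)
    refine eq_of_primeAt_eq (hw.trans h) h (le_antisymm (primeAt_le_primeAt hw h) ?_)
    rw [hz, Ideal.span_singleton_le_iff_mem]
    exact Ideal.mem_of_dvd _ h2.symm.dvd hρw

theorem exists_prime_primeAt_eq_span {z : Y} (h : z ⤳ x) (hz : Order.coheight z = 1) :
    ∃ π : Y.presheaf.stalk x, Prime π ∧ primeAt h = Ideal.span {π} := by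
  obtain ⟨h1, h2⟩ := coheight_eq_one_iff.mp hz
  obtain ⟨π, hπz, hπ⟩ := Ideal.IsPrime.exists_mem_prime_of_ne_bot (primeAt_isPrime h)
    (fun e => h1 ((primeAt_eq_bot_iff _).mp e))
  obtain ⟨w, hw, hw1, hwπ⟩ := exists_coheight_eq_one_of_prime hπ
  have hwz : w ⤳ z := specializes_of_primeAt_le hw h (by
    rwa [hwπ, Ideal.span_singleton_le_iff_mem])
  rcases h2 w hwz with rfl | rfl
  · exact ⟨π, hπ, hwπ⟩
  · rw [coheight_genericPoint] at hw1; simp at hw1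

end Factorial

end CodimensionOne

/-! ### Orders of vanishing; rational functions on factorial local rings. -/

section Order

variable {Y : Scheme.{u}} [IsIntegral Y] [IsLocallyNoetherian Y]

theorem ord_one (z : Y) : Scheme.ord (1 : Y.functionField) z = 0 := by
  have := Scheme.ord_mul (x := z) (one_ne_zero (α := Y.functionField)) one_ne_zero
  rw [one_mul] at this
  linarith

theorem ord_inv {g : Y.functionField} (hg : g ≠ 0) (z : Y) :
    Scheme.ord g⁻¹ z = - Scheme.ord g z := by
  have := Scheme.ord_mul (x := z) hg (inv_ne_zero hg)
  rw [mul_inv_cancel₀ hg, ord_one] at this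
  linarith

theorem ord_pow {g : Y.functionField} (hg : g ≠ 0) (n : ℕ) (z : Y) :
    Scheme.ord (g ^ n) z = n * Scheme.ord g z := by
  induction n with
  | zero => simp [ord_one]
  | succ n ih => rw [pow_succ, Scheme.ord_mul (pow_ne_zero n hg) hg, ih]; push_cast; ring

theorem ord_zpow {g : Y.functionField} (hg : g ≠ 0) (n : ℤ) (z : Y) :
    Scheme.ord (g ^ n) z = n * Scheme.ord g z := by
  obtain ⟨m, rfl | rfl⟩ := n.eq_nat_or_neg
  · rw [zpow_natCast, ord_pow hg]
  · rw [zpow_neg, zpow_natCast, ord_inv (pow_ne_zero m hg), ord_pow hg]; ring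

theorem ord_prod {I : Type*} (s : Finset I) (g : I → Y.functionField) (hg : ∀ i ∈ s, g i ≠ 0)
    (z : Y) : Scheme.ord (∏ i ∈ s, g i) z = ∑ i ∈ s, Scheme.ord (g i) z := by
  classical
  induction s using Finset.induction_on with
  | empty => simp [ord_one]
  | insert i s hi ih =>
    rw [Finset.prod_insert hi, Finset.sum_insert hi, Scheme.ord_mul (hg i (by simp))
      (Finset.prod_ne_zero_iff.mpr fun j hj => hg j (by simp [hj])),
      ih fun j hj => hg j (by simp [hj])]

theorem ord_algebraMap_self_nonneg {z : Y} (hz : Order.coheight z = 1) {a : Y.presheaf.stalk z}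
    (ha : a ≠ 0) : 0 ≤ Scheme.ord (algebraMap _ Y.functionField a) z := by
  have := krullDimLE_of_coheight_le hz.le
  rw [Scheme.le_ord_iff hz (algebraMap_ne_zero ha)]
  exact Ring.ordFrac_ge_one_of_ne_zero ha

theorem ord_algebraMap_nonneg {z x : Y} (h : z ⤳ x) {a : Y.presheaf.stalk x} (ha : a ≠ 0) :
    0 ≤ Scheme.ord (algebraMap _ Y.functionField a) z := by
  by_cases hz : Order.coheight z = 1
  · rw [← algebraMap_stalkSpecializes h]
    exact ord_algebraMap_self_nonneg hz fun h0 =>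
      ha (stalkSpecializes_injective h (by rw [h0, map_zero]))
  · rw [Scheme.ord_eq_zero_of_coheight_neq_one hz]

variable [IsRegularScheme Y]

theorem ord_algebraMap_self_eq_zero_iff {z : Y} (hz : Order.coheight z = 1)
    {a : Y.presheaf.stalk z} (ha : a ≠ 0) :
    Scheme.ord (algebraMap _ Y.functionField a) z = 0 ↔ IsUnit a := by
  have := isDiscreteValuationRing_stalk z hz
  rw [Scheme.ord_eq_iff hz (algebraMap_ne_zero ha)]
  exact Ring.isUnit_iff_ordFrac_one_of_isDiscreteValuationRing.symm

theorem ord_algebraMap_eq_zero_iff {z x : Y} (h : z ⤳ x) (hz : Order.coheight z = 1)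
    {a : Y.presheaf.stalk x} (ha : a ≠ 0) :
    Scheme.ord (algebraMap _ Y.functionField a) z = 0 ↔ a ∉ primeAt h := by
  rw [← algebraMap_stalkSpecializes h, ord_algebraMap_self_eq_zero_iff hz fun h0 =>
      ha (stalkSpecializes_injective h (by rw [h0, map_zero])), mem_primeAt_iff, not_not]

theorem ord_algebraMap_irreducible {z : Y} (hz : Order.coheight z = 1) {t : Y.presheaf.stalk z}
    (ht : Irreducible t) : Scheme.ord (algebraMap _ Y.functionField t) z = 1 := by
  have := isDiscreteValuationRing_stalk z hz
  rw [Scheme.ord_eq_iff hz (algebraMap_ne_zero ht.ne_zero)]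
  exact Ring.ordFrac_irreducible ht

/-- The ring 𝒪_z is the localization of 𝒪_x at (π), so π remains a generator of its maximal ideal.
-/
theorem ord_algebraMap_of_primeAt_eq_span {z x : Y} (h : z ⤳ x) (hz : Order.coheight z = 1)
    {π : Y.presheaf.stalk x} (hπ : primeAt h = Ideal.span {π}) :
    Scheme.ord (algebraMap _ Y.functionField π) z = 1 := by
  have := isDiscreteValuationRing_stalk z hz
  rw [← algebraMap_stalkSpecializes h]
  refine ord_algebraMap_irreducible hz
    ((IsDiscreteValuationRing.irreducible_iff_uniformizer _).mpr (le_antisymm (fun t ht => ?_) ?_))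
  · obtain ⟨a, s, hs, e⟩ := exists_stalkSpecializes_mul_eq h t
    have ha : a ∈ primeAt h := by
      change (Y.presheaf.stalkSpecializes h).hom a ∈ IsLocalRing.maximalIdeal (Y.presheaf.stalk z)
      rw [← e]
      exact Ideal.mul_mem_left _ _ ht
    rw [hπ, Ideal.mem_span_singleton] at ha
    rw [mem_primeAt_iff, not_not] at hs
    rw [Ideal.mem_span_singleton, ← hs.dvd_mul_left, e]
    exact map_dvd _ ha
  · rw [Ideal.span_singleton_le_iff_mem]
    change π ∈ primeAt h
    rw [hπ]
    exact Ideal.mem_span_singleton_self π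

/-- On a factorial local ring, a rational function without poles is regular. -/
theorem exists_algebraMap_eq_of_ord_nonneg {x : Y} [UniqueFactorizationMonoid (Y.presheaf.stalk x)]
    {g : Y.functionField} (hg : g ≠ 0)
    (h : ∀ z : Y, z ⤳ x → Order.coheight z = 1 → 0 ≤ Scheme.ord g z) :
    ∃ a : Y.presheaf.stalk x, algebraMap _ Y.functionField a = g := by
  obtain ⟨a, b, hab, rfl⟩ := IsFractionRing.exists_reduced_fraction (A := Y.presheaf.stalk x) g
  have hb0 : (b : Y.presheaf.stalk x) ≠ 0 := nonZeroDivisors.ne_zero b.2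
  have ha0 : a ≠ 0 := fun e => hg (by rw [e, IsLocalization.mk'_zero])
  by_cases hb : IsUnit (b : Y.presheaf.stalk x)
  · obtain ⟨c, hc⟩ := hb.exists_right_inv
    refine ⟨a * c, ?_⟩
    rw [eq_comm, IsLocalization.mk'_eq_iff_eq_mul, ← map_mul, mul_assoc, mul_comm c, hc, mul_one]
  -- A prime factor of the reduced denominator does not divide the numerator, so it gives a prime
  -- divisor through x along which g has a pole.
  · obtain ⟨π, hπ, hπb⟩ := WfDvdMonoid.exists_irreducible_factor hb hb0
    obtain ⟨z, hzx, hz, hzπ⟩ := exists_coheight_eq_one_of_prime hπ.prime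
    have h1 := h z hzx hz
    have h2 : Scheme.ord (algebraMap _ Y.functionField a) z = 0 := by
      rw [ord_algebraMap_eq_zero_iff hzx hz ha0, hzπ, Ideal.mem_span_singleton]
      exact fun hπa => hπ.not_isUnit (hab hπa hπb)
    have h3 : Scheme.ord (algebraMap _ Y.functionField (b : Y.presheaf.stalk x)) z ≠ 0 := by
      rw [Ne, ord_algebraMap_eq_zero_iff hzx hz hb0, not_not, hzπ, Ideal.mem_span_singleton]
      exact hπb
    have h4 := ord_algebraMap_nonneg hzx hb0
    have h5 := Scheme.ord_mul (x := z) hg (algebraMap_ne_zero hb0)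
    rw [IsLocalization.mk'_spec, h2] at h5
    omega

/-- On a factorial local ring, Weil divisors are principal. -/
theorem exists_ord_eq {x : Y} [UniqueFactorizationMonoid (Y.presheaf.stalk x)] (A : Y → ℤ)
    (hA : {z : Y | Order.coheight z = 1 ∧ A z ≠ 0}.Finite) :
    ∃ e : Y.functionField, e ≠ 0 ∧
      ∀ z : Y, z ⤳ x → Order.coheight z = 1 → Scheme.ord e z = A z := by
  classical
  have key : ∀ z : Y, ∃ f : Y.functionField, f ≠ 0 ∧ (z ⤳ x → Order.coheight z = 1 →
      ∀ w : Y, w ⤳ x → Order.coheight w = 1 → Scheme.ord f w = if w = z then 1 else 0) := by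
    intro z
    by_cases hz : z ⤳ x ∧ Order.coheight z = 1
    · obtain ⟨π, hπ, hzπ⟩ := exists_prime_primeAt_eq_span hz.1 hz.2
      refine ⟨algebraMap _ _ π, algebraMap_ne_zero hπ.ne_zero, fun _ _ w hw hw1 => ?_⟩
      split_ifs with hwz
      · subst hwz
        exact ord_algebraMap_of_primeAt_eq_span hw hw1 hzπ
      · rw [ord_algebraMap_eq_zero_iff hw hw1 hπ.ne_zero]
        intro hπw
        have hzw : z ⤳ w := specializes_of_primeAt_le hz.1 hw (by
          rwa [hzπ, Ideal.span_singleton_le_iff_mem])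
        rcases (coheight_eq_one_iff.mp hw1).2 z hzw with e | e
        · exact hwz e.symm
        · exact (coheight_eq_one_iff.mp hz.2).1 e
    · exact ⟨1, one_ne_zero, fun h1 h2 => absurd ⟨h1, h2⟩ hz⟩
  choose f hf0 hf using key
  refine ⟨∏ z ∈ hA.toFinset with z ⤳ x, f z ^ A z,
    Finset.prod_ne_zero_iff.mpr fun z _ => zpow_ne_zero _ (hf0 z), fun w hw hw1 => ?_⟩
  rw [ord_prod _ _ fun z _ => zpow_ne_zero _ (hf0 z)]
  have h1 : ∀ z ∈ hA.toFinset.filter (· ⤳ x), Scheme.ord (f z ^ A z) w =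
      if w = z then A z else 0 := by
    intro z hz
    simp only [Finset.mem_filter, Set.Finite.mem_toFinset, Set.mem_ofPred_eq] at hz
    rw [ord_zpow (hf0 z), hf z hz.2 hz.1.1 w hw hw1]
    split_ifs <;> simp
  rw [Finset.sum_congr rfl h1, Finset.sum_ite_eq]
  split_ifs with h2
  · rfl
  · simp only [Finset.mem_filter, Set.Finite.mem_toFinset, Set.mem_ofPred_eq, hw1, hw, true_and,
      and_true, not_not] at h2
    exact h2.symm

end Order

/-! ### Finiteness of the divisor of a rational function. -/

section Finiteness

open TopologicalSpace in
/-- A closed subset of a Noetherian sober space has only finitely many points without proper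
generizations in it. -/
theorem finite_setOf_minimal_generizations {X : Type*} [TopologicalSpace X] [NoetherianSpace X]
    [QuasiSober X] {C : Set X} (hC : IsClosed C) :
    {z | z ∈ C ∧ ∀ w ∈ C, w ⤳ z → w = z}.Finite := by
  obtain ⟨S, hS, hcl, hirr, hCS⟩ := NoetherianSpace.exists_finite_set_isClosed_irreducible hC
  have key : ∀ t ∈ S, ∃ w : X, IsGenericPoint w t := fun t ht =>
    QuasiSober.sober (hirr t ht) (hcl t ht)
  rcases isEmpty_or_nonempty X with hX | hX
  · exact Set.toFinite _
  choose! w hw using key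
  refine (hS.image w).subset fun z hz => ?_
  obtain ⟨t, ht, hzt⟩ : ∃ t ∈ S, z ∈ t := by
    have := hz.1
    rwa [hCS, Set.mem_sUnion] at this
  refine ⟨t, ht, hz.2 _ ?_ ((hw t ht).specializes hzt)⟩
  rw [hCS]
  exact ⟨t, ht, (hw t ht).mem⟩

variable {Y : Scheme.{u}} [IsIntegral Y] [IsLocallyNoetherian Y]

theorem finite_setOf_coheight_eq_one_of_isClosed [CompactSpace Y] {C : Set Y} (hC : IsClosed C)
    (hη : genericPoint Y ∉ C) : {z : Y | z ∈ C ∧ Order.coheight z = 1}.Finite := by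
  have : AlgebraicGeometry.IsNoetherian Y := {}
  refine (finite_setOf_minimal_generizations hC).subset fun z hz => ⟨hz.1, fun w hw hwz => ?_⟩
  exact ((coheight_eq_one_iff.mp hz.2).2 w hwz).resolve_right fun e => hη (e ▸ hw)

/-- A nonzero g is a unit on some nonempty open set, so its zeros and poles are codimension-one
points of a proper closed subset. -/
theorem finite_setOf_ord_ne_zero [CompactSpace Y] (g : Y.functionField) :
    {z : Y | Scheme.ord g z ≠ 0}.Finite := by
  by_cases hg : g = 0
  · simp [hg]
  obtain ⟨U, -, g', hU, rfl, hu⟩ := exists_isUnit_germ_eq Y g hg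
  refine (finite_setOf_coheight_eq_one_of_isClosed (C := (U : Set Y)ᶜ) U.isOpen.isClosed_compl
    ?_).subset fun z hz => ⟨fun hzU => hz (Scheme.ord_of_isUnit hu hzU), ?_⟩
  · rw [Set.notMem_compl_iff]
    exact ((genericPoint_spec Y).mem_open_set_iff U.isOpen).mpr (by simpa using hU)
  · by_contra h
    exact hz (Scheme.ord_eq_zero_of_coheight_neq_one h _)

end Finiteness

/-! ### Sections of 𝒪(A): gluing, local generators and orders along a prime divisor. -/

section Sections

variable {Y : Scheme.{u}} [IsIntegral Y]

/-- A rational function which is regular at every point is a global section. -/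
theorem exists_germToFunctionField_eq (g : Y.functionField)
    (h : ∀ x : Y, ∃ a : Y.presheaf.stalk x, algebraMap _ Y.functionField a = g) :
    ∃ s : Γ(Y, ⊤), Y.presheaf.germ ⊤ (genericPoint Y) trivial s = g := by
  have key : ∀ x : Y, ∃ (U : Y.Opens) (_ : x ∈ U) (hη : genericPoint Y ∈ U) (s : Γ(Y, U)),
      Y.presheaf.germ U (genericPoint Y) hη s = g := by
    intro x
    obtain ⟨a, ha⟩ := h x
    obtain ⟨U, hxU, s, rfl⟩ := Y.presheaf.exists_germ_eq a
    have : Nonempty U := ⟨⟨x, hxU⟩⟩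
    refine ⟨U, hxU, (genericPoint_specializes x).mem_open U.isOpen hxU, s, ?_⟩
    rw [Scheme.algebraMap_germ_eq_germToFunctionField] at ha
    exact ha
  choose U hxU hη s hs using key
  obtain ⟨t, ht, -⟩ := Y.sheaf.existsUnique_gluing' U ⊤ (fun x => homOfLE le_top)
    (fun x _ => TopologicalSpace.Opens.mem_iSup.mpr ⟨x, hxU x⟩) s (by
      intro x y
      refine germ_injective_of_isIntegral Y (genericPoint Y) (U := U x ⊓ U y) ⟨hη x, hη y⟩ ?_
      refine (Y.presheaf.germ_res_apply (TopologicalSpace.Opens.infLELeft (U x) (U y)) _ _ _).trans ?_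
      refine Eq.trans ?_ (Y.presheaf.germ_res_apply (TopologicalSpace.Opens.infLERight (U x) (U y)) _ _ _).symm
      exact (hs x).trans (hs y).symm)
  refine ⟨t, ?_⟩
  rw [← hs (genericPoint Y), ← ht (genericPoint Y)]
  exact (Y.presheaf.germ_res_apply (homOfLE le_top) _ _ _).symm

variable [IsLocallyNoetherian Y]

theorem ord_smul {x : Y} {a : Y.presheaf.stalk x} {e : Y.functionField} (ha : a ≠ 0)
    (he : e ≠ 0) (z : Y) :
    Scheme.ord (a • e) z = Scheme.ord (algebraMap _ Y.functionField a) z + Scheme.ord e z := by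
  rw [Algebra.smul_def, Scheme.ord_mul (algebraMap_ne_zero ha) he]

variable [IsRegularScheme Y]

/-- At a point with factorial local ring, the stalk of `𝒪(A)` is free of rank one. -/
theorem exists_stalkO_eq_span {x : Y} [UniqueFactorizationMonoid (Y.presheaf.stalk x)] (A : Y → ℤ)
    (hA : {z : Y | Order.coheight z = 1 ∧ A z ≠ 0}.Finite) :
    ∃ e : Y.functionField, e ≠ 0 ∧ stalkO A x = Submodule.span (Y.presheaf.stalk x) {e} ∧
      ∀ z : Y, z ⤳ x → Order.coheight z = 1 → Scheme.ord e z = - A z := by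
  obtain ⟨e, he0, he⟩ := exists_ord_eq (x := x) (fun z => - A z) (by simpa using hA)
  refine ⟨e, he0, le_antisymm (fun g hg => ?_) ?_, he⟩
  · by_cases hg0 : g = 0
    · rw [hg0]; exact zero_mem _
    obtain ⟨a, ha⟩ := exists_algebraMap_eq_of_ord_nonneg (x := x)
      (mul_ne_zero hg0 (inv_ne_zero he0)) (fun z hz hz1 => by
        rw [Scheme.ord_mul hg0 (inv_ne_zero he0), ord_inv he0, he z hz hz1, neg_neg]
        exact hg hg0 z hz hz1)
    refine Submodule.mem_span_singleton.mpr ⟨a, ?_⟩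
    rw [Algebra.smul_def, ha, inv_mul_cancel_right₀ he0]
  · rw [Submodule.span_singleton_le_iff_mem]
    intro _ z hz hz1
    rw [he z hz hz1]
    omega

/-- A section of `𝒪(A)` not vanishing along `Z` has nonnegative order at every point `x` of `Z`;
this order is zero unless the divisor of the section contains `x`. -/
theorem exists_hasOrderAt {v x : Y} [UniqueFactorizationMonoid (Y.presheaf.stalk x)] (A : Y → ℤ)
    (hA : {z : Y | Order.coheight z = 1 ∧ A z ≠ 0}.Finite) (h : v ⤳ x)
    (hv : Order.coheight v = 1) {g : Y.functionField} (hg0 : g ≠ 0) (hg : g ∈ stalkO A x)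
    (hgv : Scheme.ord g v + A v = 0) :
    ∃ n : ℤ, 0 ≤ n ∧ HasOrderAt A h g n ∧
      (n ≠ 0 → ∃ z : Y, z ⤳ x ∧ Order.coheight z = 1 ∧ Scheme.ord g z + A z ≠ 0) := by
  obtain ⟨e, he0, hspan, he⟩ := exists_stalkO_eq_span (x := x) A hA
  rw [hspan] at hg
  obtain ⟨a, rfl⟩ := Submodule.mem_span_singleton.mp hg
  have ha0 : a ≠ 0 := by rintro rfl; simp at hg0
  have hord : ∀ z : Y, z ⤳ x → Order.coheight z = 1 →
      Scheme.ord (a • e) z + A z = Scheme.ord (algebraMap _ Y.functionField a) z := by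
    intro z hz hz1
    rw [ord_smul ha0 he0, he z hz hz1]
    ring
  have hav : a ∉ primeAt h := by
    rw [← ord_algebraMap_eq_zero_iff h hv ha0, ← hord v h hv, hgv]
  -- Since g is a section, it is a multiple of the generator e and the denominator can be 1; this
  -- makes the order nonnegative.
  refine ⟨((Ring.ord (Y.presheaf.stalk x ⧸ primeAt h) (Ideal.Quotient.mk _ a)).toNat : ℤ),
    Int.natCast_nonneg _, ⟨e, hspan, a, 1, hav, ?_, one_smul _ _, ?_⟩, ?_⟩
  · exact (Ideal.ne_top_iff_one _).mp (primeAt_isPrime h).ne_top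
  · rw [map_one, Ring.ord_one]; simp
  · intro hn
    have hau : ¬ IsUnit a := fun hu => hn (by
      rw [Ring.ord_of_isUnit (hu.map (Ideal.Quotient.mk (primeAt h)))]; simp)
    obtain ⟨π, hπ, hπa⟩ := WfDvdMonoid.exists_irreducible_factor hau ha0
    obtain ⟨z, hzx, hz1, hzπ⟩ := exists_coheight_eq_one_of_prime hπ.prime
    refine ⟨z, hzx, hz1, ?_⟩
    rw [hord z hzx hz1, Ne, ord_algebraMap_eq_zero_iff hzx hz1 ha0, not_not, hzπ,
      Ideal.mem_span_singleton]
    exact hπa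

/-- A section of `𝒪(A)` whose divisor does not contain `Z` is nonzero in the stalk of `𝒪(A)|_Z` at
the generic point of `Z`. -/
theorem stalkRestrict_mk_ne_zero {v : Y} (A : Y → ℤ) (hv : Order.coheight v = 1)
    {g : Y.functionField} (hg0 : g ≠ 0) (hg : g ∈ stalkO A v) (hgv : Scheme.ord g v + A v = 0) :
    (Submodule.Quotient.mk ⟨g, hg⟩ : StalkRestrict A (specializes_rfl : v ⤳ v)) ≠ 0 := by
  intro h
  rw [Submodule.Quotient.mk_eq_zero, primeAt_refl] at h
  -- Multiplying by the maximal ideal raises the order along v by at least one. Lowering A by 1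
  -- everywhere is harmless, as v is the only codimension-one generization of v.
  have hmem : ∀ y : stalkO A v, y ∈ IsLocalRing.maximalIdeal (Y.presheaf.stalk v) •
      (⊤ : Submodule (Y.presheaf.stalk v) (stalkO A v)) → y.1 ∈ stalkO (fun z => A z - 1) v := by
    intro y hy
    refine Submodule.smul_induction_on hy (fun a ha n _ => ?_) fun y y' hy hy' => add_mem hy hy'
    · intro hne z hz hz1
      have hzv : z = v := ((coheight_eq_one_iff.mp hv).2 z hz).resolve_right
        (coheight_eq_one_iff.mp hz1).1
      subst hzv
      have ha0 : a ≠ 0 := by rintro rfl; simp at hne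
      have hn0 : n.1 ≠ 0 := by intro e; simp [e] at hne
      have h1 := n.2 hn0 z hz hz1
      have h2 := ord_algebraMap_self_nonneg hz1 ha0
      have h3 := (ord_algebraMap_self_eq_zero_iff hz1 ha0).not.mpr
        ((IsLocalRing.mem_maximalIdeal a).mp ha)
      have h4 : Scheme.ord (a • n : stalkO A z).1 z =
        Scheme.ord (algebraMap _ Y.functionField a) z + Scheme.ord n.1 z := ord_smul ha0 hn0 z
      change 0 ≤ Scheme.ord (a • n : stalkO A z).1 z + (A z - 1)
      omega
  have := hmem _ h hg0 v specializes_rfl hv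
  simp only at this
  omega

end Sections

/-! ### Function fields and orders under open immersions. -/

section OpenImmersion

variable {U Y : Scheme.{u}} [IsIntegral U] [IsIntegral Y] (i : U ⟶ Y) [IsOpenImmersion i]

/-- The isomorphism of function fields induced by an open immersion. -/
noncomputable def functionFieldEquiv : Y.functionField ≃+* U.functionField :=
  (Y.presheaf.stalkCongr (.of_eq (genericPoint_eq_of_isOpenImmersion i).symm) ≪≫
    asIso (i.stalkMap (genericPoint U))).commRingCatIsoToRingEquiv

theorem functionFieldEquiv_algebraMap (y : U) (a : Y.presheaf.stalk (i y)) :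
    functionFieldEquiv i (algebraMap _ Y.functionField a) =
      algebraMap _ U.functionField ((i.stalkMap y).hom a) := by
  have h1 := Scheme.Hom.stalkSpecializes_stalkMap_apply i _ _ (genericPoint_specializes y) a
  refine Eq.trans ?_ h1
  refine congrArg (i.stalkMap (genericPoint U)).hom ?_
  exact stalkSpecializes_trans_apply
    (specializes_of_eq (genericPoint_eq_of_isOpenImmersion i)) (genericPoint_specializes (i y)) a

variable [IsLocallyNoetherian U] [IsLocallyNoetherian Y] [IsRegularScheme U] [IsRegularScheme Y]

theorem ord_functionFieldEquiv (g : Y.functionField) (y : U) :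
    Scheme.ord (functionFieldEquiv i g) y = Scheme.ord g (i y) := by
  have hco : Order.coheight (i y) = Order.coheight y := coheight_eq_of_isOpenImmersion i
  by_cases hy : Order.coheight y = 1
  · by_cases hg : g = 0
    · simp [hg]
    have hy' := hco.trans hy
    have := isDiscreteValuationRing_stalk y hy
    have := isDiscreteValuationRing_stalk (i y) hy'
    rw [Scheme.ord_eq_iff hy (by simpa using hg), ← (Scheme.ord_eq_iff hy' hg).mp rfl]
    exact ordFrac_ringEquiv (asIso (i.stalkMap y)).commRingCatIsoToRingEquiv
      (functionFieldEquiv i : Y.functionField →+* U.functionField)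
      (functionFieldEquiv_algebraMap i y) g
  · rw [Scheme.ord_eq_zero_of_coheight_neq_one hy,
      Scheme.ord_eq_zero_of_coheight_neq_one (hco.trans_ne hy)]

end OpenImmersion

/-! ### Dimension of the fibres of a semistable curve. -/

section Dimension

/-- The points in a fibre of an integral morphism have no proper specializations in that fibre. -/
theorem eq_of_specializes_of_isIntegralHom {X Y : Scheme.{u}} (p : X ⟶ Y) [IsIntegralHom p]
    {w y : X} (h : w ⤳ y) (hp : p w = p y) : w = y := by
  obtain ⟨_, ⟨U, hU, rfl⟩, hyU, -⟩ :=
    Y.isBasis_affineOpens.exists_subset_of_mem_open (Set.mem_univ (p y)) isOpen_univ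
  have hV : IsAffineOpen (p ⁻¹ᵁ U) := hU.preimage p
  have hyV : y ∈ p ⁻¹ᵁ U := hyU
  have hwV : w ∈ p ⁻¹ᵁ U := h.mem_open (p ⁻¹ᵁ U).isOpen hyV
  let I : ∀ z : X, z ∈ p ⁻¹ᵁ U → Ideal Γ(X, p ⁻¹ᵁ U) := fun z hz =>
    (IsLocalRing.maximalIdeal (X.presheaf.stalk z)).comap (X.presheaf.germ _ z hz).hom
  have hI : ∀ z hz b, b ∈ I z hz ↔ z ∉ X.basicOpen b := fun z hz b => by
    rw [Scheme.mem_basicOpen X b z hz]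
    exact IsLocalRing.mem_maximalIdeal _
  have hle : I w hwV ≤ I y hyV := fun b hb => by
    rw [hI] at hb ⊢
    exact fun hy => hb (h.mem_open (X.basicOpen b).isOpen hy)
  have hcomap : ∀ z hz a, a ∈ (I z hz).comap (p.app U).hom ↔ p z ∉ Y.basicOpen a := fun z hz a => by
    rw [Ideal.mem_comap, hI]
    change z ∉ X.basicOpen (p.app U a) ↔ _
    rw [← Scheme.preimage_basicOpen]
    rfl
  have heq : I w hwV = I y hyV := by
    by_contra hne
    algebraize [(p.app U).hom]
    -- Incomparability: a strict inclusion of primes in an integral extension contracts to a strict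
    -- inclusion, but both contract to the prime of p y.
    have : Algebra.IsIntegral Γ(Y, U) Γ(X, p ⁻¹ᵁ U) := ⟨p.isIntegral_app U hU⟩
    have : (I w hwV).IsPrime := Ideal.IsPrime.comap _
    have hlt := Ideal.IsIntegral.comap_lt_comap (R := Γ(Y, U)) (lt_of_le_of_ne hle hne)
    refine hlt.ne ?_
    ext a
    refine (hcomap w hwV a).trans ((hcomap y hyV a).trans ?_).symm
    rw [hp]
  refine (h.antisymm (specializes_iff_forall_open.mpr fun O hO hwO => ?_)).eq
  obtain ⟨b, hbO, hwb⟩ := hV.exists_basicOpen_le (V := ⟨O, hO⟩) ⟨w, hwO⟩ hwV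
  refine hbO ?_
  by_contra hyb
  rw [← hI y hyV, ← heq, hI] at hyb
  exact hyb hwb

/-- One-dimensionality descends along flat integral surjective morphisms. -/
theorem coheight_eq_one_of_flat_of_isIntegralHom {X Y : Scheme.{u}} (p : X ⟶ Y) [IsIntegralHom p]
    [Flat p] [Surjective p]
    (hX : ∀ x : X, IsClosed ({x} : Set X) → Order.coheight x = 1) (y : Y)
    (hy : IsClosed ({y} : Set Y)) : Order.coheight y = 1 := by
  obtain ⟨x, rfl⟩ := p.surjective y
  have hx : IsClosed ({x} : Set X) := by
    refine isClosed_of_closure_subset fun x' hx' => ?_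
    have h1 : x ⤳ x' := specializes_iff_mem_closure.mpr hx'
    have h2 : p x' ∈ ({p x} : Set Y) := (h1.map p.continuous).mem_closed hy rfl
    exact (eq_of_specializes_of_isIntegralHom p h1 h2.symm).symm
  have hx1 := hX x hx
  refine le_antisymm ?_ ?_
  · refine (Order.coheight_le_coe_iff (n := 1)).mpr fun w hw => ?_
    by_contra hc
    have h1 : Order.coheight w ≠ 0 := fun h0 => hc (by rw [h0]; simp)
    rw [Order.coheight_ne_zero, not_isMax_iff] at h1
    obtain ⟨w', hw'⟩ := h1
    -- Going down for flat morphisms lifts a chain of two proper generizations of p x to one of x,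
    -- which is too long.
    obtain ⟨a, hax, rfl⟩ := Flat.generalizingMap p (show w ⤳ p x from hw.le)
    obtain ⟨b, hba, rfl⟩ := Flat.generalizingMap p (show w' ⤳ p a from hw'.le)
    have h2 := Order.coheight_add_one_le
      (lt_of_specializes_of_ne hax (by rintro rfl; exact lt_irrefl _ hw))
    have h3 := Order.coheight_add_one_le
      (lt_of_specializes_of_ne hba (by rintro rfl; exact lt_irrefl _ hw'))
    rw [hx1] at h2
    have h4 : Order.coheight b + 1 + 1 ≤ 0 + 1 := by
      rw [zero_add]; exact (add_le_add_left h3 1).trans h2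
    have h5 := (ENat.add_le_add_iff_right ENat.one_ne_top).mp h4
    simp at h5
  · rw [Order.one_le_iff_ne_zero, Order.coheight_ne_zero, not_isMax_iff]
    have h0 : Order.coheight x ≠ 0 := by rw [hx1]; simp
    rw [Order.coheight_ne_zero, not_isMax_iff] at h0
    obtain ⟨w, hw⟩ := h0
    refine ⟨p w, lt_of_specializes_of_ne (Specializes.map (show w ⤳ x from hw.le) p.continuous)
      fun e => ?_⟩
    have := eq_of_specializes_of_isIntegralHom p (show w ⤳ x from hw.le) e
    exact hw.ne this.symm

/-- The fibres of a semistable curve are one-dimensional. -/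
theorem IsSemistable.coheight_eq_one {X S : Scheme.{u}} {f : X ⟶ S} (hf : IsSemistable f)
    (k : Type u) [Field k] (s : Spec (.of k) ⟶ S) (y : (pullback f s : Scheme.{u}))
    (hy : IsClosed ({y} : Set (pullback f s : Scheme.{u}))) : Order.coheight y = 1 := by
  let t : Spec (.of (AlgebraicClosure k)) ⟶ Spec (.of k) :=
    Spec.map (CommRingCat.ofHom (algebraMap k (AlgebraicClosure k)))
  have hIntegral : IsIntegralHom t :=
    IsIntegralHom.SpecMap_iff.mpr (algebraMap_isIntegral_iff.mpr inferInstance)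
  have hflat : Flat t := Flat.SpecMap_iff.mpr
    ((RingHom.flat_algebraMap_iff (R := k) (S := AlgebraicClosure k)).mpr inferInstance)
  have hsurj : Surjective t := ⟨fun z => ⟨IsLocalRing.closedPoint (AlgebraicClosure k),
    (PrimeSpectrum.instUnique (R := k)).instSubsingleton.elim _ _⟩⟩
  -- The definition speaks of geometric fibres only, so the dimension is descended from the base
  -- change to an algebraic closure.
  refine coheight_eq_one_of_flat_of_isIntegralHom (pullback.fst (pullback.snd f s) t)
    (fun x hx => ?_) y hy
  let e := pullbackLeftPullbackSndIso f s t
  have h1 := (hf.nodal (AlgebraicClosure k) (t ≫ s) (e.hom x) (by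
    rw [← Set.image_singleton]
    exact e.hom.homeomorph.isClosedMap _ hx)).1
  rw [ringKrullDim_stalk_eq_coheight] at h1
  have h2 : Order.coheight (e.hom x) = Order.coheight x := coheight_eq_of_isOpenImmersion e.hom
  rw [← h2]
  exact_mod_cast h1

end Dimension

/-! ### Scalars of the base as germs; a uniformizer as equation of the special fibre. -/

section LocalEquation

variable {R : Type u} [CommRing R] {X : Scheme.{u}} (f : X ⟶ Spec (.of R))

/-- The image of an element of the base ring in the local ring at a point. -/
noncomputable def stalkScalar (r : R) (z : X) : X.presheaf.stalk z :=
  X.presheaf.germ ⊤ z trivial (f.appTop ((Scheme.ΓSpecIso (.of R)).inv r))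

theorem isUnit_stalkScalar_iff (r : R) (z : X) :
    IsUnit (stalkScalar f r z) ↔ r ∉ (f z).asIdeal := by
  rw [stalkScalar, ← Scheme.mem_basicOpen_top, ← Scheme.preimage_basicOpen_top]
  change f z ∈ (Spec (.of R)).basicOpen ((Scheme.ΓSpecIso (.of R)).inv r) ↔ _
  rw [basicOpen_eq_of_affine]
  rfl

theorem stalkSpecializes_stalkScalar (r : R) {w z : X} (h : w ⤳ z) :
    (X.presheaf.stalkSpecializes h).hom (stalkScalar f r z) = stalkScalar f r w := by
  rw [stalkScalar, stalkScalar, ← X.presheaf.germ_stalkSpecializes (TopologicalSpace.Opens.mem_top z) h]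
  rfl

theorem stalkScalar_mem_primeAt_iff (r : R) {w z : X} (h : w ⤳ z) :
    stalkScalar f r z ∈ primeAt h ↔ r ∈ (f w).asIdeal := by
  rw [mem_primeAt_iff, stalkSpecializes_stalkScalar, isUnit_stalkScalar_iff, not_not]

end LocalEquation

/-! ### The special fibre: its components and the dimension of the model along it. -/

namespace RegularSemistableModel

variable {R K : Type u} [CommRing R] [IsDomain R] [IsDiscreteValuationRing R] [Field K]
  [Algebra R K] [IsFractionRing R K] (M : RegularSemistableModel R K)

theorem mem_asIdeal_iff_eq_closedPoint {ϖ : R} (hϖ : Irreducible ϖ) (p : PrimeSpectrum R) :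
    ϖ ∈ p.asIdeal ↔ p = IsLocalRing.closedPoint R := by
  constructor
  · intro h
    refine PrimeSpectrum.ext (le_antisymm (IsLocalRing.le_maximalIdeal p.2.ne_top) ?_)
    change IsLocalRing.maximalIdeal R ≤ _
    rw [(IsDiscreteValuationRing.irreducible_iff_uniformizer ϖ).mp hϖ]
    exact (Ideal.span_singleton_le_iff_mem _).mpr h
  · rintro rfl
    exact (IsLocalRing.mem_maximalIdeal _).mpr hϖ.not_isUnit

instance : IsProper M.f := M.isProper

instance : CompactSpace M.X := (quasiCompact_iff_compactSpace M.f).mp inferInstance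

instance : IsProper M.toSpecK :=
  inferInstanceAs (IsProper (pullback.snd M.f (Spec.map (CommRingCat.ofHom (algebraMap R K)))))

instance : CompactSpace M.genericFibre :=
  (quasiCompact_iff_compactSpace M.toSpecK).mp inferInstance

theorem range_ι : Set.range M.ι = {z | M.f z ≠ IsLocalRing.closedPoint R} := by
  obtain ⟨ϖ, hϖ⟩ := IsDiscreteValuationRing.exists_irreducible R
  have := isLocalization_away_of_irreducible R K ϖ hϖ
  have h1 : Set.range M.ι =
      M.f ⁻¹' Set.range (Spec.map (CommRingCat.ofHom (algebraMap R K))) :=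
    Scheme.Pullback.range_fst _ _
  have h2 : Set.range (Spec.map (CommRingCat.ofHom (algebraMap R K))) =
      (PrimeSpectrum.basicOpen ϖ : Set (PrimeSpectrum R)) :=
    PrimeSpectrum.localization_away_comap_range K ϖ
  rw [h1, h2]
  ext z
  exact (mem_asIdeal_iff_eq_closedPoint hϖ (M.f z)).not

theorem f_ι_ne (y : M.genericFibre) : M.f (M.ι y) ≠ IsLocalRing.closedPoint R := by
  have : M.ι y ∈ Set.range M.ι := ⟨y, rfl⟩
  rwa [range_ι] at this

theorem f_genericPoint_ne : M.f (genericPoint M.X) ≠ IsLocalRing.closedPoint R := by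
  rw [← genericPoint_eq_of_isOpenImmersion M.ι]
  exact M.f_ι_ne _

theorem isClosed_specialFibre : IsClosed {z : M.X | M.f z = IsLocalRing.closedPoint R} :=
  IsClosed.preimage M.f.continuous (IsLocalRing.isClosed_singleton_closedPoint R)

theorem f_eq_closedPoint_of_specializes {v x : M.X} (h : v ⤳ x)
    (hv : M.f v = IsLocalRing.closedPoint R) : M.f x = IsLocalRing.closedPoint R :=
  h.mem_closed M.isClosed_specialFibre hv

/-- The maximal ideal at v is a minimal prime over the uniformizer, so Krull's principal ideal
theorem bounds its height by one. -/
theorem IsComponent.coheight_eq_one {v : M.X} (hv : M.IsComponent v) : Order.coheight v = 1 := by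
  obtain ⟨ϖ, hϖ⟩ := IsDiscreteValuationRing.exists_irreducible R
  have hne : v ≠ genericPoint M.X := fun e => M.f_genericPoint_ne (e ▸ hv.1)
  refine le_antisymm ?_ (Order.one_le_iff_ne_zero.mpr fun h =>
    hne (eq_genericPoint_of_coheight_eq_zero h))
  have hmem : ∀ {w : M.X} (h : w ⤳ v), stalkScalar M.f ϖ v ∈ primeAt h ↔
      M.f w = IsLocalRing.closedPoint R := fun h =>
    (stalkScalar_mem_primeAt_iff M.f ϖ h).trans (mem_asIdeal_iff_eq_closedPoint hϖ _)
  have hmin : IsLocalRing.maximalIdeal (M.X.presheaf.stalk v) ∈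
      (Ideal.span {stalkScalar M.f ϖ v}).minimalPrimes := by
    refine ⟨⟨inferInstance, ?_⟩, fun q ⟨hq, hϖq⟩ _ => ?_⟩
    · rw [Ideal.span_singleton_le_iff_mem, ← primeAt_refl]
      exact (hmem _).mpr hv.1
    · obtain ⟨w, hw, rfl⟩ := exists_primeAt_eq q
      rw [Ideal.span_singleton_le_iff_mem, hmem] at hϖq
      obtain rfl := hv.2 w hϖq hw
      rw [primeAt_refl]
  have h1 := Ideal.height_le_one_of_isPrincipal_of_mem_minimalPrimes _ _ hmin
  have h2 := IsLocalRing.maximalIdeal_height_eq_ringKrullDim (R := M.X.presheaf.stalk v)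
  rw [ringKrullDim_stalk_eq_coheight] at h2
  have h3 : (IsLocalRing.maximalIdeal (M.X.presheaf.stalk v)).height = Order.coheight v := by
    exact_mod_cast h2
  rwa [h3] at h1

theorem isComponent_of_coheight_eq_one {z : M.X} (hz : Order.coheight z = 1)
    (hf : M.f z = IsLocalRing.closedPoint R) : M.IsComponent z :=
  ⟨hf, fun w hw hwz => ((coheight_eq_one_iff.mp hz).2 w hwz).resolve_right fun e =>
    M.f_genericPoint_ne (e ▸ hw)⟩

theorem finite_setOf_isComponent : {v : M.X | M.IsComponent v}.Finite :=
  (finite_setOf_coheight_eq_one_of_isClosed M.isClosed_specialFibre M.f_genericPoint_ne).subset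
    fun _ hv => ⟨hv.1, hv.coheight_eq_one⟩

/-- Properness makes the image of the model closed, so it contains the closed point. Without a
component, the condition that all s_v be nonzero would be vacuous. -/
theorem exists_isComponent : ∃ v : M.X, M.IsComponent v := by
  have hcl : IsClosed (Set.range M.f) := by
    rw [← Set.image_univ]
    exact M.f.isClosedMap _ isClosed_univ
  obtain ⟨x, hx⟩ : IsLocalRing.closedPoint R ∈ Set.range M.f :=
    (IsLocalRing.specializes_closedPoint (M.f (genericPoint M.X))).mem_closed hcl ⟨_, rfl⟩
  obtain ⟨ϖ, hϖ⟩ := IsDiscreteValuationRing.exists_irreducible R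
  have hmem : ∀ {w : M.X} (h : w ⤳ x), stalkScalar M.f ϖ x ∈ primeAt h ↔
      M.f w = IsLocalRing.closedPoint R := fun h =>
    (stalkScalar_mem_primeAt_iff M.f ϖ h).trans (mem_asIdeal_iff_eq_closedPoint hϖ _)
  obtain ⟨q, hq, -⟩ := Ideal.exists_minimalPrimes_le (I := Ideal.span {stalkScalar M.f ϖ x})
    (J := primeAt specializes_rfl) ((Ideal.span_singleton_le_iff_mem _).mpr ((hmem _).mpr hx))
  have := hq.isPrime
  obtain ⟨v, hv, rfl⟩ := exists_primeAt_eq q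
  refine ⟨v, (hmem hv).mp ((Ideal.span_singleton_le_iff_mem _).mp hq.le), fun w hw hwv => ?_⟩
  exact eq_of_primeAt_eq (hwv.trans hv) hv (le_antisymm (primeAt_le_primeAt hwv hv)
    (hq.2 ⟨inferInstance, (Ideal.span_singleton_le_iff_mem _).mpr ((hmem _).mpr hw)⟩
      (primeAt_le_primeAt hwv hv)))

/-- Dividing 𝒪_x by the uniformizer gives a ring of dimension at most one, because the special fibre
is a curve; one equation lowers the dimension by at most one. -/
theorem coheight_le_two_of_isClosed {x : M.X} (hx : IsClosed ({x} : Set M.X))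
    (hf : M.f x = IsLocalRing.closedPoint R) : Order.coheight x ≤ 2 := by
  obtain ⟨ϖ, hϖ⟩ := IsDiscreteValuationRing.exists_irreducible R
  let s : Spec (.of (IsLocalRing.ResidueField R)) ⟶ Spec (.of R) :=
    Spec.map (CommRingCat.ofHom (IsLocalRing.residue R))
  have hs : IsClosedImmersion s :=
    IsClosedImmersion.spec_of_surjective _ IsLocalRing.residue_surjective
  let i : pullback M.f s ⟶ M.X := pullback.fst M.f s
  have hrange : ∀ z : M.X, M.f z = IsLocalRing.closedPoint R → ∃ y, i y = z := by
    intro z hz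
    have h1 : Set.range i = M.f ⁻¹' Set.range s := Scheme.Pullback.range_fst _ _
    have h2 : z ∈ Set.range i := by
      rw [h1]
      refine ⟨IsLocalRing.closedPoint _, ?_⟩
      rw [hz]
      exact IsLocalRing.comap_closedPoint (IsLocalRing.residue R)
    exact h2
  have hmem : ∀ {w : M.X} (h : w ⤳ x), stalkScalar M.f ϖ x ∈ primeAt h ↔
      M.f w = IsLocalRing.closedPoint R := fun h =>
    (stalkScalar_mem_primeAt_iff M.f ϖ h).trans (mem_asIdeal_iff_eq_closedPoint hϖ _)
  obtain ⟨y, rfl⟩ := hrange x hf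
  have hemb : Topology.IsClosedEmbedding i := i.isClosedEmbedding
  have hy : Order.coheight y = 1 := by
    refine M.isSemistable.coheight_eq_one _ s y ?_
    rw [hemb.isClosed_iff_image_isClosed, Set.image_singleton]
    exact hx
  have hdim : Ring.KrullDimLE 1 (M.X.presheaf.stalk (i y) ⧸ Ideal.span {stalkScalar M.f ϖ (i y)}) := by
    refine Ring.KrullDimLE.mk₁ fun I hI => or_iff_not_imp_left.mpr fun hmin => ?_
    obtain ⟨J, hJ, hJI⟩ : ∃ J : Ideal (M.X.presheaf.stalk (i y) ⧸
        Ideal.span {stalkScalar M.f ϖ (i y)}), J.IsPrime ∧ J < I := by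
      by_contra! hc
      exact hmin ⟨⟨hI, bot_le⟩, fun J hJ hJI => (eq_of_le_of_not_lt hJI (hc J hJ.1)).ge⟩
    have hsurj := Ideal.Quotient.mk_surjective (I := Ideal.span {stalkScalar M.f ϖ (i y)})
    have hϖ0 : ∀ q : Ideal (M.X.presheaf.stalk (i y) ⧸ Ideal.span {stalkScalar M.f ϖ (i y)}),
        stalkScalar M.f ϖ (i y) ∈ q.comap (Ideal.Quotient.mk _) := fun q => by
      rw [Ideal.mem_comap, Ideal.Quotient.eq_zero_iff_mem.mpr (Ideal.mem_span_singleton_self _)]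
      exact q.zero_mem
    obtain ⟨z, hz, hzI⟩ := exists_primeAt_eq (I.comap (Ideal.Quotient.mk _))
    obtain ⟨w, hw, hwJ⟩ := exists_primeAt_eq (J.comap (Ideal.Quotient.mk _))
    have hwz : w ⤳ z := specializes_of_primeAt_le hw hz (by
      rw [hwJ, hzI]; exact Ideal.comap_mono hJI.le)
    have hne : w ≠ z := by
      rintro rfl
      exact hJI.ne (Ideal.comap_injective_of_surjective _ hsurj (hwJ.symm.trans hzI))
    obtain ⟨z', rfl⟩ := hrange z ((hmem hz).mp (hzI ▸ hϖ0 I))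
    obtain ⟨w', rfl⟩ := hrange w ((hmem hw).mp (hwJ ▸ hϖ0 J))
    -- If z were not the closed point itself, w, z and x would form a chain of length two in the
    -- special fibre.
    have hzy : i z' = i y := by
      by_contra hzy
      have h1 := Order.coheight_add_one_le (lt_of_specializes_of_ne
        (hemb.isInducing.specializes_iff.mp hz) fun e => hzy (congrArg i e))
      have h2 := Order.coheight_add_one_le (lt_of_specializes_of_ne
        (hemb.isInducing.specializes_iff.mp hwz) fun e => hne (congrArg i e))
      rw [hy] at h1
      have h4 : Order.coheight w' + 1 + 1 ≤ 0 + 1 := by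
        rw [zero_add]; exact (add_le_add_left h2 1).trans h1
      have h5 := (ENat.add_le_add_iff_right ENat.one_ne_top).mp h4
      simp at h5
    have hmax : (I.comap (Ideal.Quotient.mk _)).IsMaximal := by
      have : I.comap (Ideal.Quotient.mk _) =
          IsLocalRing.maximalIdeal (M.X.presheaf.stalk (i y)) := by
        rw [← hzI, ← primeAt_refl]
        congr 1
      rw [this]
      infer_instance
    rw [← Ideal.map_comap_of_surjective _ hsurj I]
    refine (Ideal.map_eq_top_or_isMaximal_of_surjective _ hsurj hmax).resolve_left fun ht => ?_
    rw [Ideal.map_comap_of_surjective _ hsurj I] at ht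
    exact hI.ne_top ht
  have h1 := Ideal.height_le_ringKrullDim_quotient_add_one (r := stalkScalar M.f ϖ (i y))
    (p := IsLocalRing.maximalIdeal (M.X.presheaf.stalk (i y)))
    (by rw [← primeAt_refl]; exact (hmem _).mpr hf)
  rw [IsLocalRing.maximalIdeal_height_eq_ringKrullDim, ringKrullDim_stalk_eq_coheight] at h1
  have h2 := Ring.krullDimLE_iff.mp hdim
  have h3 : ((Order.coheight (i y) : ℕ∞) : WithBot ℕ∞) ≤ ((2 : ℕ∞) : WithBot ℕ∞) :=
    (h1.trans (add_le_add_left h2 1)).trans_eq (by norm_num [one_add_one_eq_two])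
  exact_mod_cast h3

end RegularSemistableModel

theorem uniqueFactorizationMonoid_stalk {Y : Scheme.{u}} [IsIntegral Y] [IsRegularScheme Y] {x : Y}
    (hx : Order.coheight x ≤ 2) : UniqueFactorizationMonoid (Y.presheaf.stalk x) := by
  have := IsRegularScheme.regular x
  refine uniqueFactorizationMonoid_of_ringKrullDim_le_two _ ?_
  rw [ringKrullDim_stalk_eq_coheight]
  exact WithBot.coe_le_coe.mpr hx

/-! ### From a section on the generic fibre to steps (1) to (4), and back. -/

namespace RegularSemistableModel

variable {R K : Type u} [CommRing R] [IsDomain R] [IsDiscreteValuationRing R] [Field K]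
  [Algebra R K] [IsFractionRing R K] {M : RegularSemistableModel R K}

open Classical in
theorem closure_ι (D : M.Div) (y : M.genericFibre) : closure D (M.ι y) = genericDivisor D y :=
  Finset.sum_congr rfl fun _ _ => if_congr M.ι.isOpenEmbedding.injective.eq_iff rfl rfl

theorem exists_of_closure_ne_zero {D : M.Div} {z : M.X} (h : closure D z ≠ 0) :
    ∃ P ∈ D.support, M.ι P.pt = z := by
  by_contra! hc
  refine h (Finset.sum_eq_zero fun P hP => if_neg (hc P hP))

theorem closure_eq_zero (D : M.Div) {z : M.X} (hz : M.f z = IsLocalRing.closedPoint R) :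
    closure D z = 0 := by
  by_contra h
  obtain ⟨P, -, rfl⟩ := exists_of_closure_ne_zero h
  exact M.f_ι_ne _ hz

theorem twist_eq_zero (φ : M.Component → ℤ) {z : M.X} (hz : ¬ M.IsComponent z) : twist φ z = 0 :=
  dif_neg hz

theorem twist_ι (φ : M.Component → ℤ) (y : M.genericFibre) : twist φ (M.ι y) = 0 :=
  twist_eq_zero φ fun h => M.f_ι_ne y h.1

theorem twist_component (φ : M.Component → ℤ) (v : M.Component) : twist φ v.1 = φ v :=
  dif_pos v.2

theorem finite_setOf_ne_zero (D : M.Div) (φ : M.Component → ℤ) :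
    {z : M.X | (closure D + twist φ) z ≠ 0}.Finite := by
  refine ((D.support.finite_toSet.image fun P => M.ι P.pt).union
    M.finite_setOf_isComponent).subset fun z hz => ?_
  by_cases h : closure D z = 0
  · right
    by_contra hc
    exact hz (by rw [Pi.add_apply, h, twist_eq_zero φ hc, add_zero])
  · left
    obtain ⟨P, hP, hPz⟩ := exists_of_closure_ne_zero h
    exact ⟨P, hP, hPz⟩

/-- Only finitely many closed points of a component lie on another given prime divisor. -/
theorem finite_setOf_isClosed_of_specializes (v : M.Component) {z : M.X} (hz : Order.coheight z = 1)
    (hzv : z ≠ v.1) : {x : M.X | v.1 ⤳ x ∧ IsClosed ({x} : Set M.X) ∧ z ⤳ x}.Finite := by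
  have : AlgebraicGeometry.IsNoetherian M.X := {}
  have hC : IsClosed (_root_.closure {v.1} ∩ _root_.closure {z} : Set M.X) :=
    isClosed_closure.inter isClosed_closure
  refine (finite_setOf_minimal_generizations hC).subset fun x hx => ⟨⟨hx.1.mem_closure,
    hx.2.2.mem_closure⟩, fun w hw hwx => ?_⟩
  -- Otherwise w lies strictly between v and x, so x has codimension at least three.
  by_contra hne
  have h1 := Order.coheight_add_one_le (lt_of_specializes_of_ne hwx hne)
  have hvw : v.1 ⤳ w := specializes_iff_mem_closure.mpr hw.1
  have hzw : z ⤳ w := specializes_iff_mem_closure.mpr hw.2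
  have hvw' : v.1 ≠ w := by
    rintro rfl
    rcases (coheight_eq_one_iff.mp v.2.coheight_eq_one).2 z hzw with e | e
    · exact hzv e
    · exact (coheight_eq_one_iff.mp hz).1 e
  have h2 := Order.coheight_add_one_le (lt_of_specializes_of_ne hvw hvw')
  have h3 := M.coheight_le_two_of_isClosed hx.2.1 (M.f_eq_closedPoint_of_specializes hx.1 v.2.1)
  rw [v.2.coheight_eq_one] at h2
  have h4 : (1 + 1 + 1 : ℕ∞) ≤ 2 := (add_le_add_left h2 1).trans (h1.trans h3)
  exact absurd h4 (by decide)

/-- The degree is computed with g itself, whose orders on X_v are nonnegative. They vanish except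
where X_v meets another prime divisor of div g + A, that is, at finitely many closed points. -/
theorem nonnegDegrees_of_section {A : M.X → ℤ} (hA : {z : M.X | A z ≠ 0}.Finite)
    {g : M.X.functionField} (hg0 : g ≠ 0) (hg : ∀ x, g ∈ stalkO A x)
    (hgv : ∀ v : M.Component, Scheme.ord g v.1 + A v.1 = 0) : NonnegDegrees A := by
  intro v
  have key : ∀ x : {x : M.X // v.1 ⤳ x ∧ IsClosed ({x} : Set M.X)}, ∃ n : ℤ, 0 ≤ n ∧
      HasOrderAt A x.2.1 g n ∧
      (n ≠ 0 → ∃ z : M.X, z ⤳ x.1 ∧ Order.coheight z = 1 ∧ Scheme.ord g z + A z ≠ 0) := by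
    intro x
    have := uniqueFactorizationMonoid_stalk (M.coheight_le_two_of_isClosed x.2.2
      (M.f_eq_closedPoint_of_specializes x.2.1 v.2.1))
    exact exists_hasOrderAt A (hA.subset fun z hz => hz.2) x.2.1 v.2.coheight_eq_one hg0 (hg x.1)
      (hgv v)
  choose n hn0 hn hnz using key
  have hT : {z : M.X | Order.coheight z = 1 ∧ Scheme.ord g z + A z ≠ 0}.Finite := by
    refine ((finite_setOf_ord_ne_zero g).union hA).subset fun z hz => ?_
    by_contra hc
    simp only [Set.mem_union, Set.mem_ofPred_eq, not_or, not_not] at hc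
    exact hz.2 (by rw [hc.1, hc.2, add_zero])
  have hfin : (Function.support n).Finite := by
    refine Set.Finite.of_finite_image (f := Subtype.val) ?_ Subtype.val_injective.injOn
    refine (hT.biUnion (t := fun z => {x : M.X | z ≠ v.1 ∧ v.1 ⤳ x ∧ IsClosed ({x} : Set M.X) ∧
      z ⤳ x}) fun z hz => ?_).subset ?_
    · by_cases hzv : z = v.1
      · simp [hzv]
      · exact (finite_setOf_isClosed_of_specializes v hz.1 hzv).subset fun x hx => hx.2
    · rintro _ ⟨x, hx, rfl⟩
      obtain ⟨z, hzx, hz1, hz⟩ := hnz x hx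
      exact Set.mem_biUnion (show z ∈ _ from ⟨hz1, hz⟩)
        ⟨fun e => hz (e ▸ hgv v), x.2.1, x.2.2, hzx⟩
  refine ⟨_, ?_, g, Finsupp.ofSupportFinite n hfin, hn, rfl⟩
  exact Finset.sum_nonneg fun x _ => mul_nonneg (hn0 x) (Int.natCast_nonneg _)

theorem toFibre_mk {A : M.X → ℤ} {v x : M.X} (h : v ⤳ x) (g : stalkO A x) :
    toFibre A h (Submodule.Quotient.mk g) = Submodule.Quotient.mk g :=
  Submodule.factor_mk (Submodule.smul_mono_left (primeAt_le h)) g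

/-- The restrictions of a global section of `𝒪(A)` to the components of the special fibre. -/
noncomputable def restrictSections {A : M.X → ℤ} {g : M.X.functionField} (hg : ∀ x, g ∈ stalkO A x) :
    SectionFamily A := fun _ =>
  { val := fun x _ => Submodule.Quotient.mk ⟨g, hg x⟩
    isLocal := fun _ _ => ⟨⊤, trivial, g, fun y _ => ⟨hg y, fun _ => rfl⟩⟩ }

theorem restrictSections_agreeAtNodes {A : M.X → ℤ} {g : M.X.functionField}
    (hg : ∀ x, g ∈ stalkO A x) : (restrictSections hg).AgreeAtNodes :=
  fun _ _ _ hv hw => (toFibre_mk hv _).trans (toFibre_mk hw _).symm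

theorem restrictSections_extends {A : M.X → ℤ} {g : M.X.functionField}
    (hg : ∀ x, g ∈ stalkO A x) : (restrictSections hg).Extends :=
  ⟨g, hg, fun _ _ _ => rfl⟩

theorem restrictSections_nonzero {A : M.X → ℤ} {g : M.X.functionField}
    (hg : ∀ x, g ∈ stalkO A x) (hg0 : g ≠ 0)
    (hgv : ∀ v : M.Component, Scheme.ord g v.1 + A v.1 = 0) : (restrictSections hg).Nonzero :=
  fun v => ⟨v.1, specializes_rfl,
    stalkRestrict_mk_ne_zero _ v.2.coheight_eq_one hg0 (hg v.1) (hgv v)⟩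

theorem SectionFamily.Extends.exists_ne_zero {A : M.X → ℤ} {s : SectionFamily A} (hs : s.Nonzero)
    (he : s.Extends) : ∃ g : M.X.functionField, g ≠ 0 ∧ ∀ x, g ∈ stalkO A x := by
  obtain ⟨g, hg, hgs⟩ := he
  obtain ⟨v, hv⟩ := M.exists_isComponent
  obtain ⟨x, hx, hne⟩ := hs ⟨v, hv⟩
  refine ⟨g, ?_, hg⟩
  rintro rfl
  exact hne ((hgs _ _ _).trans (Submodule.Quotient.mk_zero _))

theorem mem_H0_iff {D : M.Div} {g : M.genericFibre.functionField} (hg0 : g ≠ 0) : g ∈ H0 D ↔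
    ∀ z : M.genericFibre, Order.coheight z = 1 → 0 ≤ Scheme.ord g z + genericDivisor D z :=
  ⟨fun hg z hz => hg z hg0 z specializes_rfl hz, fun h _ _ z _ hz => h z hz⟩

theorem functionFieldEquiv_mem_H0_iff {D : M.Div} {g : M.X.functionField} (hg0 : g ≠ 0) :
    functionFieldEquiv M.ι g ∈ H0 D ↔ ∀ y : M.genericFibre, Order.coheight (M.ι y) = 1 →
      0 ≤ Scheme.ord g (M.ι y) + closure D (M.ι y) := by
  rw [mem_H0_iff ((map_ne_zero_iff _ (functionFieldEquiv M.ι).injective).mpr hg0)]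
  refine forall_congr' fun y => ?_
  rw [ord_functionFieldEquiv, closure_ι,
    show Order.coheight (M.ι y) = Order.coheight y from coheight_eq_of_isOpenImmersion M.ι]

theorem SatisfiesX.exists_mem_H0 {D : M.Div} (h : SatisfiesX D) : ∃ g ∈ H0 D, g ≠ 0 := by
  obtain ⟨φ, -, s, hs, -, he⟩ := h
  obtain ⟨g, hg0, hg⟩ := he.exists_ne_zero hs
  refine ⟨functionFieldEquiv M.ι g, (functionFieldEquiv_mem_H0_iff hg0).mpr fun y hy => ?_,
    (map_ne_zero_iff _ (functionFieldEquiv M.ι).injective).mpr hg0⟩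
  have h1 := hg (M.ι y) hg0 (M.ι y) specializes_rfl hy
  rwa [Pi.add_apply, twist_ι, add_zero] at h1

theorem satisfiesX_of_mem_H0 {D : M.Div} {g : M.X.functionField} (hg0 : g ≠ 0)
    (hg' : functionFieldEquiv M.ι g ∈ H0 D) : SatisfiesX D := by
  rw [functionFieldEquiv_mem_H0_iff hg0] at hg'
  -- The only twist for which g is a section along every component without vanishing on any.
  let φ : M.Component → ℤ := fun v => - Scheme.ord g v.1
  have hgv : ∀ v : M.Component, Scheme.ord g v.1 + (closure D + twist φ) v.1 = 0 := by
    intro v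
    rw [Pi.add_apply, twist_component, closure_eq_zero D v.2.1]
    ring
  have hg : ∀ x, g ∈ stalkO (closure D + twist φ) x := by
    intro x _ z _ hz
    by_cases hfz : M.f z = IsLocalRing.closedPoint R
    · exact (hgv ⟨z, M.isComponent_of_coheight_eq_one hz hfz⟩).ge
    · obtain ⟨y, rfl⟩ : z ∈ Set.range M.ι := by rw [range_ι]; exact hfz
      rw [Pi.add_apply, twist_ι, add_zero]
      exact hg' y hz
  exact ⟨φ, nonnegDegrees_of_section (finite_setOf_ne_zero D φ) hg0 hg hgv, restrictSections hg,
    restrictSections_nonzero hg hg0 hgv, restrictSections_agreeAtNodes hg,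
    restrictSections_extends hg⟩

/-- The steps (1) to (4) amount to the existence of a nonzero section on the generic fibre. -/
theorem satisfiesX_iff (D : M.Div) : SatisfiesX D ↔ ∃ g ∈ H0 D, g ≠ 0 := by
  refine ⟨SatisfiesX.exists_mem_H0, fun ⟨g', hg', hg0'⟩ => ?_⟩
  obtain ⟨g, rfl⟩ := (functionFieldEquiv M.ι).surjective g'
  exact satisfiesX_of_mem_H0 (fun e => hg0' (by rw [e, map_zero])) hg'

/-! ### Rational points of the generic fibre and evaluation at them. -/

theorem coheight_eq_one_of_isClosed {y : M.genericFibre} (hy : IsClosed ({y} : Set M.genericFibre)) :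
    Order.coheight y = 1 :=
  M.isSemistable.coheight_eq_one K (Spec.map (CommRingCat.ofHom (algebraMap R K))) y hy

theorem algebraMap_stalkScalar (c : K) (z : M.genericFibre) :
    algebraMap _ M.genericFibre.functionField (stalkScalar M.toSpecK c z) =
      algebraMap K M.genericFibre.functionField c :=
  stalkSpecializes_stalkScalar M.toSpecK c (genericPoint_specializes z)

namespace Points

/-- A section of a separated morphism is a closed immersion. -/
theorem isClosed_pt (P : M.Points) : IsClosed ({P.pt} : Set M.genericFibre) := by
  have h1 : IsClosedImmersion (P.1 ≫ M.toSpecK) := by rw [P.2]; infer_instance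
  have h2 : IsClosedImmersion P.1 := IsClosedImmersion.of_comp P.1 M.toSpecK
  have h3 : Set.range P.1 = {P.pt} := by
    refine Set.Subset.antisymm ?_ (Set.singleton_subset_iff.mpr ⟨_, rfl⟩)
    rintro _ ⟨x, rfl⟩
    exact congrArg P.1 ((PrimeSpectrum.instUnique (R := K)).instSubsingleton.elim x _)
  rw [← h3]
  exact P.1.isClosedEmbedding.isClosed_range

theorem coheight_pt (P : M.Points) : Order.coheight P.pt = 1 :=
  coheight_eq_one_of_isClosed P.isClosed_pt

/-- Evaluation of germs at a rational point. -/
noncomputable def eval (P : M.Points) : M.genericFibre.presheaf.stalk P.pt →+* K :=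
  (Scheme.stalkClosedPointTo P.1).hom

instance (P : M.Points) : IsLocalHom P.eval :=
  inferInstanceAs (IsLocalHom (Scheme.stalkClosedPointTo P.1).hom)

theorem eval_stalkScalar (P : M.Points) (c : K) : P.eval (stalkScalar M.toSpecK c P.pt) = c := by
  have h1 : M.toSpecK.appTop ≫ P.1.appTop = 𝟙 _ := by
    rw [← Scheme.Hom.comp_appTop, P.2]; rfl
  have h2 : M.genericFibre.presheaf.germ ⊤ P.pt trivial ≫ Scheme.stalkClosedPointTo P.1 =
      P.1.appTop ≫ (Scheme.ΓSpecIso (.of K)).hom := by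
    refine (Scheme.germ_stalkClosedPointTo P.1 ⊤ trivial).trans ?_
    simp
    rfl
  have h3 : (Scheme.ΓSpecIso (.of K)).inv ≫ M.toSpecK.appTop ≫
      M.genericFibre.presheaf.germ ⊤ P.pt trivial ≫ Scheme.stalkClosedPointTo P.1 = 𝟙 _ := by
    rw [h2, ← Category.assoc M.toSpecK.appTop, h1, Category.id_comp, Iso.inv_hom_id]
  exact congrArg (fun φ => φ.hom c) h3

theorem mem_maximalIdeal_iff (P : M.Points) (u : M.genericFibre.presheaf.stalk P.pt) :
    u ∈ IsLocalRing.maximalIdeal (M.genericFibre.presheaf.stalk P.pt) ↔ P.eval u = 0 := by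
  rw [IsLocalRing.mem_maximalIdeal, mem_nonunits_iff, ← isUnit_map_iff P.eval, isUnit_iff_ne_zero,
    not_not]

/-- Evaluation is determined by the point: a germ differs from the scalar that is its value by an
element of the maximal ideal, which every K-point there kills, and scalars evaluate to themselves.
-/
theorem pt_injective : Function.Injective (pt : M.Points → M.genericFibre) := by
  intro P Q h
  refine Subtype.ext ((SpecToEquivOfLocalRing M.genericFibre (.of K)).injective
    (SpecToEquivOfLocalRing_eq_iff.mpr ⟨h, ?_⟩))
  refine CommRingCat.hom_ext (RingHom.ext fun (u : M.genericFibre.presheaf.stalk P.pt) => ?_)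
  have hQP : Q.pt ⤳ P.pt := specializes_of_eq h.symm
  change P.eval u = Q.eval ((M.genericFibre.presheaf.stalkSpecializes hQP).hom u)
  have h1 : u - stalkScalar M.toSpecK (P.eval u) P.pt ∈ primeAt hQP := by
    have : primeAt hQP = IsLocalRing.maximalIdeal (M.genericFibre.presheaf.stalk P.pt) := by
      refine le_antisymm (primeAt_le hQP) ?_
      rw [← primeAt_refl]
      exact primeAt_le_primeAt (specializes_of_eq h) hQP
    rw [this, mem_maximalIdeal_iff, map_sub, eval_stalkScalar, sub_self]
  have h2 := (Q.mem_maximalIdeal_iff _).mp h1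
  rw [map_sub, map_sub, stalkSpecializes_stalkScalar, eval_stalkScalar, sub_eq_zero] at h2
  exact h2.symm

end Points

/-! ### Subtracting one rational point from a divisor. -/

open Classical in
theorem genericDivisor_sub_single (D : M.Div) (P : M.Points) (z : M.genericFibre) :
    genericDivisor (D - Finsupp.single P 1) z =
      genericDivisor D z - if P.pt = z then 1 else 0 := by
  unfold genericDivisor
  rw [Finsupp.sum_sub_index (fun _ _ _ => by split_ifs <;> simp), Finsupp.sum_single_index (by simp)]

theorem mem_H0_sub_single_iff {D : M.Div} {P : M.Points} {g : M.genericFibre.functionField}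
    (hg0 : g ≠ 0) : g ∈ H0 (D - Finsupp.single P 1) ↔
      g ∈ H0 D ∧ 1 ≤ Scheme.ord g P.pt + genericDivisor D P.pt := by
  rw [mem_H0_iff hg0, mem_H0_iff hg0]
  simp only [genericDivisor_sub_single]
  constructor
  · refine fun h => ⟨fun z hz => ?_, ?_⟩
    · have := h z hz
      split_ifs at this <;> omega
    · have := h P.pt P.coheight_pt
      rw [if_pos rfl] at this
      omega
  · rintro ⟨h1, h2⟩ z hz
    split_ifs with hPz
    · subst hPz
      omega
    · have := h1 z hz
      omega

theorem H0_sub_single_le (D : M.Div) (P : M.Points) : H0 (D - Finsupp.single P 1) ≤ H0 D := by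
  intro g hg
  by_cases hg0 : g = 0
  · rw [hg0]; exact zero_mem _
  · exact ((mem_H0_sub_single_iff hg0).mp hg).1

/-- The sections of `𝒪(D)` vanishing at a rational point have codimension at most one. -/
theorem exists_sub_smul_mem {D : M.Div} {P : M.Points} {g₁ g₂ : M.genericFibre.functionField}
    (h₁ : g₁ ∈ H0 D) (h₂ : g₂ ∈ H0 D) (h₂' : g₂ ∉ H0 (D - Finsupp.single P 1)) :
    ∃ c : K, g₁ - c • g₂ ∈ H0 (D - Finsupp.single P 1) := by
  by_cases hg₁ : g₁ = 0
  · exact ⟨0, by rw [hg₁, zero_smul, sub_zero]; exact zero_mem _⟩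
  have hg₂ : g₂ ≠ 0 := fun e => h₂' (by rw [e]; exact zero_mem _)
  have ho₁ := (mem_H0_iff hg₁).mp h₁ P.pt P.coheight_pt
  have ho₂ := (mem_H0_iff hg₂).mp h₂ P.pt P.coheight_pt
  rw [mem_H0_sub_single_iff hg₂, not_and] at h₂'
  have ho₂' := h₂' h₂
  have := uniqueFactorizationMonoid_stalk (P.coheight_pt.le.trans (by decide : (1 : ℕ∞) ≤ 2))
  -- By `h₂'` the function g₂ has the least order allowed at P, so u = g₁ / g₂ is regular there; the
  -- scalar sought is its value at P.
  obtain ⟨u, hu⟩ := exists_algebraMap_eq_of_ord_nonneg (x := P.pt)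
    (mul_ne_zero hg₁ (inv_ne_zero hg₂)) (fun z hz hz1 => by
      obtain rfl := ((coheight_eq_one_iff.mp P.coheight_pt).2 z hz).resolve_right
        (coheight_eq_one_iff.mp hz1).1
      rw [Scheme.ord_mul hg₁ (inv_ne_zero hg₂), ord_inv hg₂]
      omega)
  have hg : g₁ - P.eval u • g₂ = (u - stalkScalar M.toSpecK (P.eval u) P.pt) • g₂ := by
    rw [Algebra.smul_def, Algebra.smul_def, map_sub, hu, algebraMap_stalkScalar, sub_mul,
      inv_mul_cancel_right₀ hg₂]
  refine ⟨P.eval u, ?_⟩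
  by_cases hne : g₁ - P.eval u • g₂ = 0
  · rw [hne]; exact zero_mem _
  refine (mem_H0_sub_single_iff hne).mpr ⟨sub_mem h₁ (Submodule.smul_mem _ _ h₂), ?_⟩
  rw [hg] at hne ⊢
  have hu0 : u - stalkScalar M.toSpecK (P.eval u) P.pt ≠ 0 := fun e => hne (by rw [e, zero_smul])
  have hum := (P.mem_maximalIdeal_iff (u - stalkScalar M.toSpecK (P.eval u) P.pt)).mpr (by
    rw [map_sub, Points.eval_stalkScalar, sub_self])
  rw [ord_smul hu0 hg₂]
  have h3 := ord_algebraMap_self_nonneg P.coheight_pt hu0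
  have h4 := (ord_algebraMap_self_eq_zero_iff P.coheight_pt hu0).not.mpr
    ((IsLocalRing.mem_maximalIdeal _).mp hum)
  omega

/-- Phrased with a spanning vector instead of dimensions, so that it also serves to prove
finiteness. -/
theorem exists_H0_le_sup_span (D : M.Div) (P : M.Points) :
    ∃ g : M.genericFibre.functionField, H0 D ≤ H0 (D - Finsupp.single P 1) ⊔ Submodule.span K {g} := by
  by_cases h : ∃ g ∈ H0 D, g ∉ H0 (D - Finsupp.single P 1)
  · obtain ⟨g, hg, hg'⟩ := h
    refine ⟨g, fun g₁ hg₁ => ?_⟩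
    obtain ⟨c, hc⟩ := exists_sub_smul_mem hg₁ hg hg'
    rw [← sub_add_cancel g₁ (c • g)]
    exact Submodule.add_mem_sup hc (Submodule.smul_mem _ _ (Submodule.mem_span_singleton_self g))
  · push Not at h
    exact ⟨0, le_sup_of_le_left h⟩

/-! ### Finite-dimensionality of H⁰. -/

theorem exists_appTop_of_mem_H0_zero {g : M.genericFibre.functionField} (hg : g ∈ H0 (0 : M.Div)) :
    ∃ s : Γ(M.genericFibre, ⊤),
      M.genericFibre.presheaf.germ ⊤ (genericPoint M.genericFibre) trivial s = g := by
  refine exists_germToFunctionField_eq g fun x => ?_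
  by_cases hg0 : g = 0
  · exact ⟨0, by rw [map_zero, hg0]⟩
  obtain ⟨y, hy, hycl⟩ := isClosed_closure.exists_closed_singleton
    (⟨x, subset_closure rfl⟩ : (_root_.closure {x} : Set M.genericFibre).Nonempty)
  have hxy : x ⤳ y := specializes_iff_mem_closure.mpr hy
  have := uniqueFactorizationMonoid_stalk
    ((coheight_eq_one_of_isClosed hycl).le.trans (by decide : (1 : ℕ∞) ≤ 2))
  obtain ⟨a, ha⟩ := exists_algebraMap_eq_of_ord_nonneg (x := y) hg0 (fun z _ hz => by
    have := (mem_H0_iff hg0).mp hg z hz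
    simpa [genericDivisor] using this)
  exact ⟨_, (algebraMap_stalkSpecializes hxy a).trans ha⟩

/-- A rational function without poles is a global function, and the global functions on a proper
integral K-scheme form a finite K-algebra. -/
theorem finite_H0_zero : Module.Finite K (H0 (0 : M.Div)) := by
  let ψ : CommRingCat.of K ⟶ Γ(M.genericFibre, ⊤) :=
    (Scheme.ΓSpecIso (.of K)).inv ≫ M.toSpecK.appTop
  have hψ : ψ.hom.Finite := by
    rw [CommRingCat.hom_comp]
    exact (finite_appTop_of_universallyClosed K M.toSpecK).comp
      (RingHom.Finite.of_surjective _
        (Scheme.ΓSpecIso (.of K)).symm.commRingCatIsoToRingEquiv.surjective)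
  let := ψ.hom.toAlgebra
  have : Module.Finite K Γ(M.genericFibre, ⊤) := hψ
  let θ : Γ(M.genericFibre, ⊤) →ₗ[K] M.genericFibre.functionField :=
    { toFun := M.genericFibre.presheaf.germ ⊤ (genericPoint M.genericFibre) trivial
      map_add' := map_add _
      map_smul' := fun c s => by
        rw [Algebra.smul_def, map_mul, RingHom.id_apply, Algebra.smul_def]
        rfl }
  have hle : H0 (0 : M.Div) ≤ LinearMap.range θ := fun g hg => exists_appTop_of_mem_H0_zero hg
  exact Submodule.finiteDimensional_of_le hle

theorem finite_H0_iff_sub_single (D : M.Div) (P : M.Points) :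
    Module.Finite K (H0 D) ↔ Module.Finite K (H0 (D - Finsupp.single P 1)) := by
  constructor
  · intro h
    exact Submodule.finiteDimensional_of_le (H0_sub_single_le D P)
  · intro h
    obtain ⟨g, hg⟩ := exists_H0_le_sup_span D P
    exact Submodule.finiteDimensional_of_le hg

theorem finite_H0_iff_add_single (D : M.Div) (P : M.Points) (n : ℤ) :
    Module.Finite K (H0 (Finsupp.single P n + D)) ↔ Module.Finite K (H0 D) := by
  induction n with
  | zero => rw [Finsupp.single_zero, zero_add]
  | succ n ih =>
    have h : Finsupp.single P ((n : ℤ) + 1) + D - Finsupp.single P 1 =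
        Finsupp.single P (n : ℤ) + D := by
      rw [Finsupp.single_add]
      abel
    rw [finite_H0_iff_sub_single _ P, h, ih]
  | pred n ih =>
    have h : Finsupp.single P (-(n : ℤ)) + D - Finsupp.single P 1 =
        Finsupp.single P (-(n : ℤ) - 1) + D := by
      rw [Finsupp.single_sub]
      abel
    rw [← ih, finite_H0_iff_sub_single (Finsupp.single P (-(n : ℤ)) + D) P, h]

theorem finite_H0 (D : M.Div) : Module.Finite K (H0 D) := by
  induction D using Finsupp.induction with
  | zero => exact finite_H0_zero
  | single_add P n D _ _ ih => exact (finite_H0_iff_add_single D P n).mpr ih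

instance (D : M.Div) : Module.Finite K (H0 D) := finite_H0 D

/-! ### Variation of h⁰ and computation of the rank. -/

/-- The dimension of `H⁰(𝒪(D))`. -/
noncomputable def h0 (D : M.Div) : ℕ := Module.finrank K (H0 D)

theorem satisfiesX_iff_h0_pos (D : M.Div) : SatisfiesX D ↔ 0 < h0 D := by
  rw [satisfiesX_iff, h0, Module.finrank_pos_iff, Submodule.nontrivial_iff_ne_bot,
    Submodule.ne_bot_iff]

theorem h0_sub_single_le (D : M.Div) (P : M.Points) : h0 (D - Finsupp.single P 1) ≤ h0 D :=
  Submodule.finrank_mono (H0_sub_single_le D P)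

theorem h0_le_h0_sub_single_add_one (D : M.Div) (P : M.Points) :
    h0 D ≤ h0 (D - Finsupp.single P 1) + 1 := by
  obtain ⟨g, hg⟩ := exists_H0_le_sup_span D P
  refine (Submodule.finrank_mono hg).trans ((Submodule.finrank_add_le_finrank_add_finrank _ _).trans ?_)
  exact Nat.add_le_add_left ((finrank_span_le_card {g}).trans (by simp)) _

theorem exists_of_genericDivisor_ne_zero {D : M.Div} {z : M.genericFibre}
    (h : genericDivisor D z ≠ 0) : ∃ P ∈ D.support, P.pt = z := by
  by_contra! hc
  exact h (Finset.sum_eq_zero fun P hP => if_neg (hc P hP))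

/-- For a nonzero section g, any P off the support of D and off the zeros and poles of g will do: g
is then a section of 𝒪(D) not vanishing at P. -/
theorem exists_h0_sub_single_add_one_eq [Infinite M.Points] {D : M.Div} (hD : 0 < h0 D) :
    ∃ P : M.Points, h0 (D - Finsupp.single P 1) + 1 = h0 D := by
  rw [← satisfiesX_iff_h0_pos, satisfiesX_iff] at hD
  obtain ⟨g, hg, hg0⟩ := hD
  have hfin : (Points.pt ⁻¹' {z : M.genericFibre | Scheme.ord g z ≠ 0} ∪ D.support).Finite :=
    ((finite_setOf_ord_ne_zero g).preimage Points.pt_injective.injOn).union D.support.finite_toSet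
  obtain ⟨P, hP⟩ := hfin.exists_notMem
  simp only [Set.mem_union, Set.mem_preimage, Set.mem_ofPred_eq, not_or, not_not] at hP
  have hDP : genericDivisor D P.pt = 0 := by
    by_contra h
    obtain ⟨Q, hQ, hQP⟩ := exists_of_genericDivisor_ne_zero h
    exact hP.2 (Points.pt_injective hQP ▸ hQ)
  have hgP : g ∉ H0 (D - Finsupp.single P 1) := by
    rw [mem_H0_sub_single_iff hg0, hP.1, hDP]
    exact fun h => absurd h.2 (by decide)
  have hlt : H0 (D - Finsupp.single P 1) < H0 D :=
    lt_of_le_not_ge (H0_sub_single_le D P) fun h => hgP (h hg)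
  have h1 := Submodule.finrank_lt_finrank_of_lt hlt
  have h2 := h0_le_h0_sub_single_add_one D P
  exact ⟨P, le_antisymm h1 h2⟩

theorem deg_add (D E : M.Div) : deg (D + E) = deg D + deg E :=
  Finsupp.sum_add_index' (fun _ => rfl) fun _ _ _ => rfl

theorem deg_single (P : M.Points) (n : ℤ) : deg (Finsupp.single P n : M.Div) = n :=
  Finsupp.sum_single_index rfl

theorem single_nonneg (P : M.Points) {n : ℤ} (hn : 0 ≤ n) : (0 : M.Div) ≤ Finsupp.single P n :=
  Finsupp.single_nonneg.mpr hn

theorem deg_nonneg {E : M.Div} (hE : 0 ≤ E) : 0 ≤ deg E :=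
  Finset.sum_nonneg fun P _ => hE P

/-- A nonzero effective divisor contains a point. -/
theorem exists_eq_add_single {E : M.Div} (hE : 0 ≤ E) (hdeg : 0 < deg E) :
    ∃ (P : M.Points) (E' : M.Div), 0 ≤ E' ∧ E = E' + Finsupp.single P 1 := by
  obtain ⟨P, -, hP⟩ := Finset.exists_lt_of_sum_lt (s := E.support) (f := fun _ => (0 : ℤ)) (g := E)
    (by simpa [deg, Finsupp.sum] using hdeg)
  refine ⟨P, E - Finsupp.single P 1, fun Q => ?_, (sub_add_cancel _ _).symm⟩
  have hQ := hE Q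
  simp only [Finsupp.coe_zero, Pi.zero_apply, Finsupp.coe_sub, Pi.sub_apply] at hQ ⊢
  by_cases h : P = Q
  · subst h
    rw [Finsupp.single_eq_same]
    omega
  · rw [Finsupp.single_eq_of_ne' h]
    omega

theorem eq_zero_of_deg_eq_zero {E : M.Div} (hE : 0 ≤ E) (hdeg : deg E = 0) : E = 0 := by
  ext P
  by_cases hP : P ∈ E.support
  · exact (Finset.sum_eq_zero_iff_of_nonneg fun Q _ => hE Q).mp hdeg P hP
  · exact Finsupp.notMem_support_iff.mp hP

theorem h0_le_h0_sub_add (D : M.Div) (n : ℕ) (E : M.Div) (hE : 0 ≤ E) (hdeg : deg E = n) :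
    h0 D ≤ h0 (D - E) + n := by
  induction n generalizing E with
  | zero => rw [eq_zero_of_deg_eq_zero hE hdeg, sub_zero, add_zero]
  | succ n ih =>
    obtain ⟨P, E', hE', rfl⟩ := exists_eq_add_single hE (by rw [hdeg]; positivity)
    rw [deg_add, deg_single] at hdeg
    have h1 := ih E' hE' (by push_cast at hdeg; linarith)
    have h2 := h0_le_h0_sub_single_add_one (D - E') P
    rw [sub_sub] at h2
    omega

/-- Well-chosen points are removed one at a time; the bound on n keeps h⁰ positive before each
removal. -/
theorem exists_h0_sub_add_eq [Infinite M.Points] (D : M.Div) (n : ℕ) (hn : n ≤ h0 D) :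
    ∃ E : M.Div, 0 ≤ E ∧ deg E = n ∧ h0 (D - E) + n = h0 D := by
  induction n with
  | zero => exact ⟨0, le_rfl, Finsupp.sum_zero_index, by rw [sub_zero, add_zero]⟩
  | succ n ih =>
    obtain ⟨E, hE, hdeg, h⟩ := ih (by omega)
    obtain ⟨P, hP⟩ := exists_h0_sub_single_add_one_eq (D := D - E) (by omega)
    refine ⟨E + Finsupp.single P 1, add_nonneg hE (single_nonneg P zero_le_one), ?_, ?_⟩
    · rw [deg_add, deg_single, hdeg]; push_cast; ring
    · rw [← sub_sub]; omega

theorem h0_sub_single_nsmul_le (D : M.Div) (P : M.Points) (n : ℕ) :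
    h0 (D - Finsupp.single P (n : ℤ)) ≤ h0 D := by
  induction n with
  | zero => simp
  | succ n ih =>
    push_cast
    rw [Finsupp.single_add, ← sub_sub]
    exact (h0_sub_single_le _ P).trans ih

theorem hasRank_satisfiesX_iff [Infinite M.Points] (D : M.Div) (r : ℤ) :
    HasRank SatisfiesX D r ↔ r = (h0 D : ℤ) - 1 := by
  simp only [HasRank, satisfiesX_iff_h0_pos, not_lt, nonpos_iff_eq_zero]
  constructor
  · rintro (⟨rfl, h⟩ | ⟨hr, h1, E, hE, hdeg, h2⟩)
    · rw [h]; rfl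
    · lift r to ℕ using hr
      have h3 := h0_le_h0_sub_add D (r + 1) E hE (by rw [hdeg]; push_cast; rfl)
      rw [h2] at h3
      by_contra hne
      obtain ⟨E', hE', hdeg', h4⟩ := exists_h0_sub_add_eq D (h0 D) le_rfl
      obtain ⟨P⟩ : Nonempty M.Points := inferInstance
      -- Here r ≥ h⁰(D), so the subtraction is not truncated. The divisor E' already kills all
      -- sections, and padding it with a multiple of P to degree r contradicts `h1`.
      have h5 := h1 (E' + Finsupp.single P ((r - h0 D : ℕ) : ℤ))
        (add_nonneg hE' (single_nonneg P (Int.natCast_nonneg _))) (by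
          rw [deg_add, deg_single, hdeg']; omega)
      have h6 := h0_sub_single_nsmul_le (D - E') P (r - h0 D)
      rw [sub_sub] at h6
      omega
  · rintro rfl
    by_cases h : h0 D = 0
    · exact Or.inl ⟨by rw [h]; rfl, h⟩
    · refine Or.inr ⟨by omega, fun E hE hdeg => ?_, ?_⟩
      · have := h0_le_h0_sub_add D (h0 D - 1) E hE (by omega)
        omega
      · obtain ⟨E, hE, hdeg, h1⟩ := exists_h0_sub_add_eq D (h0 D) le_rfl
        exact ⟨E, hE, by omega, by omega⟩

theorem rX_eq [Infinite M.Points] (D : M.Div) : rX D = ((((h0 D : ℤ) - 1 : ℤ) : ℝ) : EReal) := by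
  refine le_antisymm ?_ (le_iInf fun E => ?_)
  · obtain ⟨E, hE, hdeg, h⟩ := exists_h0_sub_add_eq D (h0 D) le_rfl
    have hS : ¬ SatisfiesX (D - E) := by rw [satisfiesX_iff_h0_pos]; omega
    exact (iInf_le _ ⟨E, hE, hS⟩).trans_eq (by simp only [hdeg])
  · obtain ⟨E, hE, h⟩ := E
    rw [satisfiesX_iff_h0_pos, not_lt, nonpos_iff_eq_zero] at h
    obtain ⟨n, hn⟩ := Int.eq_ofNat_of_zero_le (deg_nonneg hE)
    have h1 := h0_le_h0_sub_add D n E hE hn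
    rw [EReal.coe_le_coe_iff, Int.cast_le, hn]
    omega

/-- Fewer E fail the weaker condition, so the infimum runs over a smaller set. -/
theorem rank_mono {S T : M.Div → Prop} (h : ∀ D, S D → T D) (D : M.Div) : rank S D ≤ rank T D :=
  le_iInf fun E => iInf_le_of_le ⟨E.1, E.2.1, fun hS => E.2.2 (h _ hS)⟩ le_rfl

end RegularSemistableModel

end GeomRank

theorem proposition3p7 {R K : Type u} [CommRing R] [IsDomain R] [IsDiscreteValuationRing R]
    [Field K] [Algebra R K] [IsFractionRing R K]
    (M : GeomRank.RegularSemistableModel R K) (hinf : Infinite M.Points) (D : M.Div) :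
    Module.Finite K (GeomRank.RegularSemistableModel.H0 D) ∧
    (∀ r : ℤ,
      GeomRank.RegularSemistableModel.HasRank GeomRank.RegularSemistableModel.SatisfiesX D r ↔
        r = (Module.finrank K (GeomRank.RegularSemistableModel.H0 D) : ℤ) - 1) ∧
    GeomRank.RegularSemistableModel.rX D =
      (((Module.finrank K (GeomRank.RegularSemistableModel.H0 D) : ℤ) - 1 : ℤ) : ℝ) ∧
    GeomRank.RegularSemistableModel.rX D ≤ GeomRank.RegularSemistableModel.rToric D ∧
    GeomRank.RegularSemistableModel.rToric D ≤ GeomRank.RegularSemistableModel.rAb D ∧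
    GeomRank.RegularSemistableModel.rAb D ≤ GeomRank.RegularSemistableModel.rNum D :=
  ⟨GeomRank.RegularSemistableModel.finite_H0 D,
    GeomRank.RegularSemistableModel.hasRank_satisfiesX_iff D,
    GeomRank.RegularSemistableModel.rX_eq D,
    GeomRank.RegularSemistableModel.rank_mono
      (fun _ ⟨φ, h1, s, h2, h3, _⟩ => ⟨φ, h1, s, h2, h3⟩) D,
    GeomRank.RegularSemistableModel.rank_mono (fun _ ⟨φ, h1, s, h2, _⟩ => ⟨φ, h1, s, h2⟩) D,
    GeomRank.RegularSemistableModel.rank_mono (fun _ ⟨φ, h1, _⟩ => ⟨φ, h1⟩) D⟩
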